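/- **Theorem 3.1.** Let $n\ge 7$ be an integer such that the equation $x^2+x+1=0$ has a solution $r$ in $\mathbb Z_n$, and let $$K=\langle a,b,c,h \mid a^n=b^n=c^n=h^3=[a,b]=[a,c]=[b,c]=1,\ a^h=a^r,\ b^h=b^r,\ c^h=c^r\rangle,$$ where $g^h=h^{-1}gh$ (so $K$ is a semidirect product $\mathbb Z_n^3\rtimes\mathbb Z_3$). Let $K_{3,3}$ have the parts $\{u,v,w\}$ and $\{x,y,z\}$, and let $\phi$ be the voltage assignment on $K_{3,3}$ with values in $K$ given by $$\phi(u,x)=\phi(u,y)=\phi(u,z)=\phi(v,y)=\phi(w,z)=1,$$ $$\phi(v,x)=h^{-1}b,\quad \phi(v,z)=h,\quad \phi(w,x)=h^{-1}a,\quad \phi(w,y)=hc,$$ and $\phi(t,s)=\phi(s,t)^{-1}$. Let $\mathcal{NCG}_{18n^3}$ be the regular $K$-cover of $K_{3,3}$ defined by $\phi$, that is, the graph with vertex set $V(K_{3,3})\times K$ and edge set $$\{\{(s,g),(t,g\,\phi(s,t))\} : \{s,t\}\in E(K_{3,3}),\ g\in K\}.$$ Then $\mathcal{NCG}_{18n^3}$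 has exactly $18n^3$ vertices, and it is a connected cubic graph which is symmetric (its automorphism group is transitive on ordered pairs of adjacent vertices) and is not a Cayley graph. Its full automorphism group $A$ is solvable and $2$-regular of type $2^2$: $A$ is regular (transitive with trivial stabilizers) on the set of $2$-arcs, i.e. triples $(v_0,v_1,v_2)$ of vertices with $v_0,v_1$ adjacent, $v_1,v_2$ adjacent and $v_0\ne v_2$, and no element of order $2$ in $A$ interchanges two adjacent vertices. -/

import Mathlib

namespace NCG

open SimpleGraph

universe u v

section Arcs

variable {V : Type u}

/-- An `s`-arc of `Γ`: a tuple `(v₀, …, v_s)` of vertices with consecutive vertices adjacent and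
`v_{i-1} ≠ v_{i+1}` for `1 ≤ i < s`. -/
def IsArc (Γ : SimpleGraph V) (s : ℕ) (p : Fin (s + 1) → V) : Prop :=
  (∀ i : ℕ, ∀ hi : i + 1 < s + 1, Γ.Adj (p ⟨i, by omega⟩) (p ⟨i + 1, hi⟩)) ∧
  (∀ i : ℕ, ∀ hi : i + 2 < s + 1, p ⟨i, by omega⟩ ≠ p ⟨i + 2, hi⟩)

/-- A group `G` of automorphisms of `Γ` is transitive on the `s`-arcs of `Γ`. -/
def IsArcTransitive (Γ : SimpleGraph V) (G : Subgroup (Γ ≃g Γ)) (s : ℕ) : Prop :=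
  ∀ p q : Fin (s + 1) → V, IsArc Γ s p → IsArc Γ s q → ∃ f ∈ G, ∀ i, f (p i) = q i

/-- A group `G` of automorphisms of `Γ` is semiregular on the `s`-arcs of `Γ`: only the identity
fixes an `s`-arc. -/
def IsArcSemiregular (Γ : SimpleGraph V) (G : Subgroup (Γ ≃g Γ)) (s : ℕ) : Prop :=
  ∀ p : Fin (s + 1) → V, IsArc Γ s p → ∀ f ∈ G, (∀ i, f (p i) = p i) → f = 1

/-- `G` is `s`-regular on `Γ`: it is transitive and semiregular on the `s`-arcs. -/
def IsArcRegular (Γ : SimpleGraph V) (G : Subgroup (Γ ≃g Γ)) (s : ℕ) : Prop :=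
  IsArcTransitive Γ G s ∧ IsArcSemiregular Γ G s

/-- A graph is symmetric if its full automorphism group is transitive on the `1`-arcs. -/
def IsSymmetric (Γ : SimpleGraph V) : Prop :=
  IsArcTransitive Γ ⊤ 1

/-- Every vertex has exactly three neighbours. -/
def IsCubic (Γ : SimpleGraph V) : Prop :=
  ∀ x : V, (Γ.neighborSet x).ncard = 3

/-- `G` is of type `2²` on the (connected cubic) graph `Γ`: it is `2`-regular and contains no
involution interchanging the two ends of an edge. -/
def IsTypeTwoTwo (Γ : SimpleGraph V) (G : Subgroup (Γ ≃g Γ)) : Prop :=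
  IsArcRegular Γ G 2 ∧
  ¬ ∃ f ∈ G, orderOf f = 2 ∧ ∃ x y : V, Γ.Adj x y ∧ f x = y ∧ f y = x

/-- `Γ` is a Cayley graph: it is isomorphic to `Cay(G, S)` for a group `G` and an inverse-closed
set `S` not containing the identity. -/
def IsCayley (Γ : SimpleGraph V) : Prop :=
  ∃ (G : Type u) (_ : Group G) (S : Set G), (1 : G) ∉ S ∧ (∀ g ∈ S, g⁻¹ ∈ S) ∧
    Nonempty (Γ ≃g SimpleGraph.mulCayley S)

end Arcs

section Covers

/-- A voltage assignment on `Γ` with values in the group `K`. Only the values on arcs matter. -/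
structure VoltageAssignment {V : Type u} (Γ : SimpleGraph V) (K : Type v) [Group K] where
  /-- the voltage of the arc `(x, y)` -/
  volt : V → V → K
  volt_symm : ∀ x y : V, Γ.Adj x y → volt x y = (volt y x)⁻¹

/-- The voltage graph `Γ ×_φ K`, a regular `K`-cover of `Γ`: its vertex set is `V(Γ) × K` and its
edges are the pairs `{(x, g), (y, g φ(x, y))}` for `{x, y}` an edge of `Γ` and `g ∈ K`. -/
def voltageGraph {V : Type u} {Γ : SimpleGraph V} {K : Type v} [Group K]
    (φ : VoltageAssignment Γ K) : SimpleGraph (V × K) where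
  Adj p q := Γ.Adj p.1 q.1 ∧ q.2 = p.2 * φ.volt p.1 q.1
  symm := ⟨by
    rintro ⟨x, g⟩ ⟨y, k⟩ ⟨hxy, hk⟩
    refine ⟨hxy.symm, ?_⟩
    simp only at hk hxy ⊢
    rw [hk, φ.volt_symm x y hxy, inv_mul_cancel_right]⟩
  loopless := ⟨fun p hp => Γ.loopless.irrefl p.1 hp.1⟩

end Covers

section Construction

/-- Names of the generators of the voltage group. -/
inductive Gen : Type
  | a | b | c | h

/-- The relators of the voltage group; here `x ^ h` means `h⁻¹ x h`. -/
def rels (n : ℕ) (r : ZMod n) : Set (FreeGroup Gen) :=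
  let a := FreeGroup.of Gen.a
  let b := FreeGroup.of Gen.b
  let c := FreeGroup.of Gen.c
  let h := FreeGroup.of Gen.h
  {a ^ n, b ^ n, c ^ n, h ^ 3,
    a⁻¹ * b⁻¹ * a * b, a⁻¹ * c⁻¹ * a * c, b⁻¹ * c⁻¹ * b * c,
    (h⁻¹ * a * h) * (a ^ r.val)⁻¹, (h⁻¹ * b * h) * (b ^ r.val)⁻¹, (h⁻¹ * c * h) * (c ^ r.val)⁻¹}

/-- The group `K = ⟨a, b, c, h | aⁿ = bⁿ = cⁿ = h³ = [a,b] = [a,c] = [b,c] = 1,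
a^h = a^r, b^h = b^r, c^h = c^r⟩`. -/
abbrev K (n : ℕ) (r : ZMod n) : Type :=
  PresentedGroup (rels n r)

/-- The graph `K_{3,3}`: the vertices `u, v, w` are `inl 0, inl 1, inl 2` and the vertices
`x, y, z` are `inr 0, inr 1, inr 2`. -/
abbrev K33 : SimpleGraph (Fin 3 ⊕ Fin 3) :=
  completeBipartiteGraph (Fin 3) (Fin 3)

/-- The voltages of the arcs from `u, v, w` (rows) to `x, y, z` (columns). -/
def voltMatrix (n : ℕ) (r : ZMod n) : Matrix (Fin 3) (Fin 3) (K n r) :=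
  let a : K n r := PresentedGroup.of Gen.a
  let b : K n r := PresentedGroup.of Gen.b
  let c : K n r := PresentedGroup.of Gen.c
  let h : K n r := PresentedGroup.of Gen.h
  !![1, 1, 1;
     h⁻¹ * b, 1, h;
     h⁻¹ * a, h * c, 1]

/-- The voltage assignment on `K_{3,3}`. -/
def voltage (n : ℕ) (r : ZMod n) : VoltageAssignment K33 (K n r) where
  volt
    | .inl i, .inr j => voltMatrix n r i j
    | .inr j, .inl i => (voltMatrix n r i j)⁻¹
    | .inl _, .inl _ => 1
    | .inr _, .inr _ => 1
  volt_symm := by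
    rintro (i | i) (j | j) _ <;> simp

/-- The graph `NCG_{18 n³}`. -/
def ncg (n : ℕ) (r : ZMod n) : SimpleGraph ((Fin 3 ⊕ Fin 3) × K n r) :=
  voltageGraph (voltage n r)

end Construction

end NCG

namespace NCG

open SimpleGraph

/-! The voltage group is ℤ_n³ ⋊ ℤ_3 (`equivModel`), where every element outside the translations has
cube 1. Each four-cycle of K_{3,3} has a voltage with nonzero `h`-exponent, so three turns around it
lift to a closed walk of length twelve. Conversely, a closed nonbacktracking walk of length twelve
in the cover always has its fourth vertex over its starting point (`fst_four_eq`). This is a finite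
check over ℤ[ω], uniform in n: any other walk that closes in K_{3,3} has a voltage with nonzero
`h`-exponent or with a coordinate of norm between 1 and 6, which cannot vanish modulo n ≥ 7.
Automorphisms therefore respect the ends of lifted four-cycles (`map_four`), hence permute the
fibres and project to Aut(K_{3,3}) (`exists_proj`). The kernel consists of deck transformations, so
the automorphism group is solvable.

The lifts of `rotate` and `turn` (`exists_lift_rotate`, `exists_lift_turn`) cover a group of order
36, regular on the 36 two-arcs of K_{3,3}; deck transformations then give transitivity upstairs. The
transposition of y and z does not lift (`not_lift_transposition`), so the stabilizer of a two-arc is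
trivial. Consequently only two automorphisms reverse the base arc, a lift of `turn` and its inverse,
and neither is an involution because `turn` has order four. A cubic Cayley graph, by contrast,
always has an involution reversing an edge. -/

/-- Powers of a cube root of unity, indexed by `ZMod 3`. -/
def cubePow {R : Type*} [CommRing R] (ω : R) (i : ZMod 3) : R := ω ^ i.val

/-! ### The semidirect product of R³ with ℤ_3 -/

section Model

variable {R : Type*} [CommRing R] {ω : R}

theorem cube_eq_one (h : ω ^ 2 + ω + 1 = 0) : ω ^ 3 = 1 := by
  linear_combination (ω - 1) * h

theorem cubePow_zero : cubePow ω 0 = 1 := by simp [cubePow]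

theorem cubePow_one : cubePow ω 1 = ω := by
  simp [cubePow, show (1 : ZMod 3).val = 1 from rfl]

theorem cubePow_two : cubePow ω 2 = ω ^ 2 := by
  simp [cubePow, show (2 : ZMod 3).val = 2 from rfl]

theorem cubePow_add (h : ω ^ 2 + ω + 1 = 0) (i j : ZMod 3) :
    cubePow ω (i + j) = cubePow ω i * cubePow ω j := by
  rw [cubePow, cubePow, cubePow, ← pow_add, ZMod.val_add, ← pow_mod_orderOf,
    ← pow_mod_orderOf (n := i.val + j.val),
    Nat.mod_mod_of_dvd _ (orderOf_dvd_of_pow_eq_one (cube_eq_one h))]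

/-- The semidirect product of `R³` with a cyclic group of order three acting through the
powers of `ω`; the pair `(v, i)` stands for `v hⁱ`, and `h⁻¹ v h = ω v`. -/
@[ext]
structure Model {R : Type*} [CommRing R] (ω : R) where
  /-- the translation part -/
  vec : Fin 3 → R
  /-- the exponent of `h` -/
  rot : ZMod 3

instance : Mul (Model ω) := ⟨fun x y => ⟨x.vec + cubePow ω (-x.rot) • y.vec, x.rot + y.rot⟩⟩
instance : One (Model ω) := ⟨⟨0, 0⟩⟩
instance : Inv (Model ω) := ⟨fun x => ⟨-(cubePow ω x.rot • x.vec), -x.rot⟩⟩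

@[simp] theorem Model.mul_vec (x y : Model ω) :
    (x * y).vec = x.vec + cubePow ω (-x.rot) • y.vec := rfl
@[simp] theorem Model.mul_rot (x y : Model ω) : (x * y).rot = x.rot + y.rot := rfl
@[simp] theorem Model.one_vec : (1 : Model ω).vec = 0 := rfl
@[simp] theorem Model.one_rot : (1 : Model ω).rot = 0 := rfl
@[simp] theorem Model.inv_vec (x : Model ω) : x⁻¹.vec = -(cubePow ω x.rot • x.vec) := rfl
@[simp] theorem Model.inv_rot (x : Model ω) : x⁻¹.rot = -x.rot := rfl

variable [hω : Fact (ω ^ 2 + ω + 1 = 0)]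

instance : Group (Model ω) :=
  Group.ofLeftAxioms
    (fun x y z => by
      ext1
      · simp only [Model.mul_vec, Model.mul_rot, neg_add, cubePow_add hω.out, smul_add, mul_smul,
          add_assoc]
      · simp [add_assoc])
    (fun x => by ext1 <;> simp [cubePow_zero])
    (fun x => by ext1 <;> simp)

/-- The projection of the model onto the cyclic group of order three. -/
def Model.rotHom : Model ω →* Multiplicative (ZMod 3) where
  toFun x := Multiplicative.ofAdd x.rot
  map_one' := rfl
  map_mul' _ _ := rfl

/-- The inclusion of the translations into the model. -/
def Model.trans : Multiplicative (Fin 3 → R) →* Model ω where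
  toFun v := ⟨v.toAdd, 0⟩
  map_one' := rfl
  map_mul' x y := by ext1 <;> simp [cubePow_zero]

instance : Group.IsSolvable (Model ω) :=
  Group.isSolvable_of_ker_le_range (Model.trans (ω := ω)) Model.rotHom (fun x hx =>
    ⟨Multiplicative.ofAdd x.vec, Model.ext rfl (congrArg Multiplicative.toAdd hx.symm)⟩)

theorem Model.mk_pow (v : Fin 3 → R) (k : ℕ) :
    (⟨v, 0⟩ : Model ω) ^ k = ⟨(k : R) • v, 0⟩ := by
  induction k with
  | zero => ext1 <;> simp
  | succ k ih => rw [pow_succ, ih]; ext1 <;> simp [cubePow_zero, add_smul]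

/-- The cube of `(v, i)` has translation part `(1 + ω⁻ⁱ + ω⁻²ⁱ) v`, which vanishes for `i ≠ 0` since
`1 + ω + ω² = 0`. -/
theorem Model.pow_three (x : Model ω) (hx : x.rot ≠ 0) : x ^ 3 = 1 := by
  obtain ⟨v, i⟩ := x
  have h := hω.out
  have key : ∀ i : ZMod 3, i ≠ 0 → 1 + cubePow ω (-i) + cubePow ω (-(i + i)) = 0 := by
    intro i hi
    obtain rfl | rfl : i = 1 ∨ i = 2 := by revert i; decide
    · rw [show (-1 : ZMod 3) = 2 by decide, show (-(1 + 1) : ZMod 3) = 1 by decide, cubePow_one,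
        cubePow_two]
      linear_combination h
    · rw [show (-2 : ZMod 3) = 1 by decide, show (-(2 + 2) : ZMod 3) = 2 by decide, cubePow_one,
        cubePow_two]
      linear_combination h
  rw [pow_succ, pow_two]
  ext1
  · ext j
    simp only [mul_vec, mul_rot, Pi.add_apply, Pi.smul_apply, smul_eq_mul, one_vec, Pi.zero_apply]
    linear_combination v j * key i hx
  · change i + i + i = 0
    clear hx
    revert i; decide

end Model

/-! ### The presented group is the semidirect product -/

section Iso

variable {n : ℕ} {r : ZMod n}

/-- The images of the generators in the model. -/
def genModel (r : ZMod n) : Gen → Model r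
  | .a => ⟨![1, 0, 0], 0⟩
  | .b => ⟨![0, 1, 0], 0⟩
  | .c => ⟨![0, 0, 1], 0⟩
  | .h => ⟨0, 1⟩

/-- The images `f a, f b, f c, f h` of the generators satisfy the relations of the voltage group as
soon as the first three are translations and the last one has rotation part `1`. -/
theorem lift_rels [NeZero n] [hω : Fact (r ^ 2 + r + 1 = 0)] {f : Gen → Model r}
    (ha : (f .a).rot = 0) (hb : (f .b).rot = 0) (hc : (f .c).rot = 0) (hh : (f .h).rot = 1) :
    ∀ x ∈ rels n r, FreeGroup.lift f x = 1 := by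
  have key : ∀ v : Fin 3 → ZMod n, (f .h)⁻¹ * ⟨v, 0⟩ * f .h = ⟨r • v, 0⟩ := by
    intro v
    ext1
    · simp only [Model.mul_vec, Model.inv_vec, Model.inv_rot, Model.mul_rot, hh, neg_neg, add_zero, cubePow_one]
      abel
    · simp
  have comm : ∀ v w : Fin 3 → ZMod n, (⟨v, 0⟩ : Model r) * ⟨w, 0⟩ = ⟨w, 0⟩ * ⟨v, 0⟩ := by
    intro v w
    ext1 <;> simp [cubePow_zero, add_comm]
  have comm' : ∀ v w : Fin 3 → ZMod n,
      (⟨v, 0⟩ : Model r)⁻¹ * ⟨w, 0⟩⁻¹ * ⟨v, 0⟩ * ⟨w, 0⟩ = 1 := by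
    intro v w
    rw [mul_assoc, comm v w]; group
  obtain ⟨va, hva⟩ : ∃ v, f .a = ⟨v, 0⟩ := ⟨_, Model.ext rfl ha⟩
  obtain ⟨vb, hvb⟩ : ∃ v, f .b = ⟨v, 0⟩ := ⟨_, Model.ext rfl hb⟩
  obtain ⟨vc, hvc⟩ : ∃ v, f .c = ⟨v, 0⟩ := ⟨_, Model.ext rfl hc⟩
  have hone : (⟨0, 0⟩ : Model r) = 1 := rfl
  -- This holds for any translation part of `f .h`, a freedom needed by the lifts constructed below.
  have h3 : f .h ^ 3 = 1 := Model.pow_three _ (by rw [hh]; decide)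
  intro x hx
  simp only [rels, Set.mem_insert_iff, Set.mem_singleton_iff] at hx
  rcases hx with rfl | rfl | rfl | rfl | rfl | rfl | rfl | rfl | rfl | rfl <;>
    simp only [map_mul, map_inv, map_pow, FreeGroup.lift_apply_of, hva, hvb, hvc, Model.mk_pow, comm',
      key, CharP.cast_eq_zero, zero_smul, hone, h3, ZMod.natCast_val, ZMod.cast_id', id_eq,
      mul_inv_cancel]

variable (n r)

/-- The homomorphism from the presented group onto the model. -/
noncomputable def toModel [NeZero n] [Fact (r ^ 2 + r + 1 = 0)] : K n r →* Model r :=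
  PresentedGroup.toGroup (f := genModel r) (lift_rels rfl rfl rfl rfl)

variable {n r}

section Relations

open PresentedGroup

theorem rel_one {x : FreeGroup Gen} (hx : x ∈ rels n r) : (mk (rels n r) x) = 1 :=
  PresentedGroup.one_of_mem hx

theorem mk_of (g : Gen) : mk (rels n r) (FreeGroup.of g) = of g := rfl

theorem gen_pow_n {g : Gen} (hg : g ≠ .h) : (of g : K n r) ^ n = 1 := by
  have : FreeGroup.of g ^ n ∈ rels n r := by
    cases g <;> simp [rels] at hg ⊢
  simpa [mk_of] using rel_one this

theorem h_pow_three : (of Gen.h : K n r) ^ 3 = 1 := by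
  have : FreeGroup.of Gen.h ^ 3 ∈ rels n r := by simp [rels]
  simpa [mk_of] using rel_one this

theorem gen_conj {g : Gen} (hg : g ≠ .h) :
    (of Gen.h : K n r)⁻¹ * of g * of Gen.h = of g ^ r.val := by
  have : (FreeGroup.of Gen.h)⁻¹ * FreeGroup.of g * FreeGroup.of Gen.h *
      (FreeGroup.of g ^ r.val)⁻¹ ∈ rels n r := by
    cases g <;> simp [rels] at hg ⊢
  have := rel_one this
  simp only [map_mul, map_inv, map_pow] at this
  exact mul_inv_eq_one.mp this

theorem comm_of_rel {g k : Gen}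
    (h : (FreeGroup.of g)⁻¹ * (FreeGroup.of k)⁻¹ * FreeGroup.of g * FreeGroup.of k ∈ rels n r) :
    Commute (of g : K n r) (of k) := by
  have h := rel_one h
  simp only [map_mul, map_inv, mk_of] at h
  calc (of g : K n r) * of k = of k * of g * ((of g)⁻¹ * (of k)⁻¹ * of g * of k) := by group
    _ = of k * of g := by rw [h, mul_one]

theorem gen_comm {g k : Gen} (hg : g ≠ .h) (hk : k ≠ .h) :
    Commute (of g : K n r) (of k) := by
  have h1 : Commute (of Gen.a : K n r) (of Gen.b) := comm_of_rel (by simp [rels])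
  have h2 : Commute (of Gen.a : K n r) (of Gen.c) := comm_of_rel (by simp [rels])
  have h3 : Commute (of Gen.b : K n r) (of Gen.c) := comm_of_rel (by simp [rels])
  cases g <;> cases k <;> first
    | exact (hg rfl).elim
    | exact (hk rfl).elim
    | exact Commute.refl _
    | assumption
    | exact h1.symm
    | exact h2.symm
    | exact h3.symm

end Relations

theorem pow_val_add {G : Type*} [Monoid G] {m : ℕ} [NeZero m] {g : G} (hg : g ^ m = 1)
    (x y : ZMod m) : g ^ (x + y).val = g ^ x.val * g ^ y.val := by
  rw [← pow_add, ZMod.val_add, ← pow_mod_orderOf, ← pow_mod_orderOf (n := x.val + y.val),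
    Nat.mod_mod_of_dvd _ (orderOf_dvd_of_pow_eq_one hg)]

theorem pow_val_mul {G : Type*} [Monoid G] {m : ℕ} [NeZero m] {g : G} (hg : g ^ m = 1)
    (x y : ZMod m) : g ^ (x * y).val = (g ^ x.val) ^ y.val := by
  rw [← pow_mul, ZMod.val_mul, ← pow_mod_orderOf, ← pow_mod_orderOf (n := x.val * y.val),
    Nat.mod_mod_of_dvd _ (orderOf_dvd_of_pow_eq_one hg)]

open PresentedGroup in
/-- The element `a ^ v₀ * b ^ v₁ * c ^ v₂` of the voltage group. -/
def translation (v : Fin 3 → ZMod n) : K n r :=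
  of Gen.a ^ (v 0).val * of Gen.b ^ (v 1).val * of Gen.c ^ (v 2).val

theorem translation_add [NeZero n] (v w : Fin 3 → ZMod n) :
    (translation (v + w) : K n r) = translation v * translation w := by
  have hba := (gen_comm (n := n) (r := r) (g := .b) (k := .a) (by simp) (by simp)).pow_pow
    (v 1).val (w 0).val
  have hca := (gen_comm (n := n) (r := r) (g := .c) (k := .a) (by simp) (by simp)).pow_pow
    (v 2).val (w 0).val
  have hcb := (gen_comm (n := n) (r := r) (g := .c) (k := .b) (by simp) (by simp)).pow_pow
    (v 2).val (w 1).val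
  simp only [translation, Pi.add_apply]
  rw [pow_val_add (gen_pow_n (by simp)), pow_val_add (gen_pow_n (by simp)),
    pow_val_add (gen_pow_n (by simp))]
  generalize (PresentedGroup.of Gen.a : K n r) ^ (w 0).val = a' at *
  generalize (PresentedGroup.of Gen.b : K n r) ^ (v 1).val = b at *
  generalize (PresentedGroup.of Gen.b : K n r) ^ (w 1).val = b' at *
  generalize (PresentedGroup.of Gen.c : K n r) ^ (v 2).val = c at *
  simp only [mul_assoc]
  rw [← mul_assoc c a', hca.eq, ← mul_assoc b (a' * c), ← mul_assoc b a', hba.eq]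
  simp only [mul_assoc]
  rw [← mul_assoc c b', hcb.eq, mul_assoc]

theorem translation_mul_h [NeZero n] (v : Fin 3 → ZMod n) :
    (translation v : K n r) * PresentedGroup.of Gen.h =
      PresentedGroup.of Gen.h * translation (r • v) := by
  have key : ∀ g : Gen, g ≠ .h → ∀ x : ZMod n, (PresentedGroup.of g : K n r) ^ (r * x).val =
      (PresentedGroup.of Gen.h)⁻¹ * PresentedGroup.of g ^ x.val * PresentedGroup.of Gen.h := by
    intro g hg x
    rw [pow_val_mul (gen_pow_n hg), ← gen_conj hg]
    simpa using conj_pow (a := (PresentedGroup.of Gen.h : K n r)⁻¹) (b := PresentedGroup.of g)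
  simp only [translation, Pi.smul_apply, smul_eq_mul]
  rw [key _ (by simp), key _ (by simp), key _ (by simp)]
  group

theorem translation_mul_h_pow [NeZero n] (v : Fin 3 → ZMod n) (k : ℕ) :
    (translation v : K n r) * PresentedGroup.of Gen.h ^ k =
      PresentedGroup.of Gen.h ^ k * translation (r ^ k • v) := by
  induction k with
  | zero => simp
  | succ k ih =>
    rw [pow_succ, ← mul_assoc, ih, mul_assoc, translation_mul_h, smul_smul, ← pow_succ', mul_assoc]

variable [hr : Fact (r ^ 2 + r + 1 = 0)]

theorem genModel_h_pow (k : ℕ) : genModel r .h ^ k = ⟨0, k⟩ := by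
  induction k with
  | zero => ext1 <;> simp
  | succ k ih => rw [pow_succ, ih]; ext1 <;> simp [genModel]

variable [NeZero n]

variable (n r) in
/-- The homomorphism from the model to the presented group. -/
def ofModel : Model r →* K n r where
  toFun m := translation m.vec * PresentedGroup.of Gen.h ^ m.rot.val
  map_one' := by simp [translation]
  map_mul' x y := by
    -- Moving a translation to the right past `hⁱ` multiplies it by `rⁱ`; this undoes the twist in
    -- the product of the model.
    have h : (1 : ZMod n) = r ^ x.rot.val * cubePow r (-x.rot) := by
      change 1 = cubePow r x.rot * cubePow r (-x.rot)
      rw [← cubePow_add hr.out, add_neg_cancel, cubePow_zero]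
    simp only [Model.mul_vec, Model.mul_rot]
    rw [translation_add, pow_val_add h_pow_three, mul_assoc, ← mul_assoc (translation (_ • _)),
      translation_mul_h_pow, smul_smul, ← h, one_smul]
    simp only [mul_assoc]

theorem pow_val_one {G : Type*} [Monoid G] {m : ℕ} {g : G} (hg : g ^ m = 1) :
    g ^ (1 : ZMod m).val = g := by
  rw [ZMod.val_one_eq_one_mod, ← pow_mod_orderOf,
    Nat.mod_mod_of_dvd _ (orderOf_dvd_of_pow_eq_one hg), pow_mod_orderOf, pow_one]

theorem toModel_of (g : Gen) : toModel n r (PresentedGroup.of g) = genModel r g :=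
  PresentedGroup.toGroup.of (lift_rels rfl rfl rfl rfl)

variable (n r) in
/-- The voltage group is isomorphic to the model. -/
noncomputable def equivModel : K n r ≃* Model r :=
  MonoidHom.toMulEquiv (toModel n r) (ofModel n r)
    (PresentedGroup.ext fun g => by
      rw [MonoidHom.comp_apply, MonoidHom.id_apply, toModel_of]
      have h1 : ∀ g : Gen, g ≠ .h → (PresentedGroup.of g : K n r) ^ (1 : ZMod n).val =
        PresentedGroup.of g := fun g hg => pow_val_one (gen_pow_n hg)
      cases g <;>
        simp [ofModel, genModel, translation, h1, show (1 : ZMod 3).val = 1 from rfl])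
    (by
      ext1 m
      simp only [MonoidHom.comp_apply, MonoidHom.id_apply, ofModel, MonoidHom.coe_mk,
        OneHom.coe_mk, translation, map_mul, map_pow, toModel_of, genModel_h_pow]
      simp only [genModel, Model.mk_pow]
      ext1
      · ext i
        fin_cases i <;> simp [cubePow_zero]
      · simp)

theorem equivModel_of (g : Gen) : equivModel n r (PresentedGroup.of g) = genModel r g :=
  toModel_of g

variable (n r) in
theorem card_K : Nat.card (K n r) = 3 * n ^ 3 := by
  rw [Nat.card_congr (equivModel n r).toEquiv, Nat.card_congr (β := (Fin 3 → ZMod n) × ZMod 3)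
    ⟨fun m => (m.vec, m.rot), fun p => ⟨p.1, p.2⟩, fun _ => rfl, fun _ => rfl⟩]
  simp [mul_comm]

instance : Finite (K n r) :=
  Nat.finite_of_card_ne_zero (by rw [card_K]; exact mul_ne_zero (by simp) (by simp [NeZero.ne n]))

instance : Group.IsSolvable (K n r) :=
  Group.isSolvable_of_isSolvable_injective (f := (equivModel n r).toMonoidHom)
    (equivModel n r).injective

end Iso

/-! ### Walks of length twelve with voltages over ℤ[ω] -/

section Search

/-- The Eisenstein voltage of an arc of `K33`: a coordinate, two integers `x, y` and an exponent `j`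
standing for the element `(x + y ω) e hʲ`, where `e` is the corresponding basis vector. -/
def arcData : Fin 3 ⊕ Fin 3 → Fin 3 ⊕ Fin 3 → Fin 3 × ℤ × ℤ × Fin 3
  | .inl 1, .inr 0 => (1, 0, 1, 2)
  | .inl 1, .inr 2 => (0, 0, 0, 1)
  | .inl 2, .inr 0 => (0, 0, 1, 2)
  -- Since `h v = (ω⁻¹ v) h`, the voltage `hc` is `(ω² c) h`, and `ω² = -1 - ω`.
  | .inl 2, .inr 1 => (2, -1, -1, 1)
  | .inr 0, .inl 1 => (1, -1, 0, 1)
  | .inr 2, .inl 1 => (0, 0, 0, 2)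
  | .inr 0, .inl 2 => (0, -1, 0, 1)
  | .inr 1, .inl 2 => (2, -1, 0, 2)
  -- The identity, for the arcs of trivial voltage; pairs that are not arcs are irrelevant.
  | _, _ => (0, 0, 0, 0)

/-- An element of the semidirect product of `ℤ[ω]³` with a cyclic group of order three. -/
structure EisState where
  /-- coordinates with respect to `1, ω` -/
  (x₀ y₀ x₁ y₁ x₂ y₂ : ℤ)
  /-- the exponent of `h` -/
  rot : Fin 3

/-- Adding `x + y ω` to a coordinate. -/
def EisState.add (s : EisState) (k : Fin 3) (x y : ℤ) (j : Fin 3) : EisState :=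
  match k with
  | 0 => ⟨s.x₀ + x, s.y₀ + y, s.x₁, s.y₁, s.x₂, s.y₂, s.rot + j⟩
  | 1 => ⟨s.x₀, s.y₀, s.x₁ + x, s.y₁ + y, s.x₂, s.y₂, s.rot + j⟩
  | 2 => ⟨s.x₀, s.y₀, s.x₁, s.y₁, s.x₂ + x, s.y₂ + y, s.rot + j⟩

/-- Multiplication on the right by the element described by `d`. -/
def EisState.step (s : EisState) (d : Fin 3 × ℤ × ℤ × Fin 3) : EisState :=
  match s.rot with
  | 0 => s.add d.1 d.2.1 d.2.2.1 d.2.2.2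
  -- The new vector is multiplied by `ω⁻¹ = -1 - ω` here and by `ω⁻² = ω` in the next case.
  | 1 => s.add d.1 (d.2.2.1 - d.2.1) (-d.2.1) d.2.2.2
  | 2 => s.add d.1 (-d.2.2.1) (d.2.1 - d.2.2.1) d.2.2.2

/-- The norm of `x + y ω` is positive and less than seven. -/
def smallNorm (x y : ℤ) : Bool := 0 < x * x - x * y + y * y && x * x - x * y + y * y < 7

/-- A condition that shows the element to be nontrivial modulo every `n ≥ 7`. -/
def EisState.nontriv (s : EisState) : Bool :=
  s.rot ≠ 0 || smallNorm s.x₀ s.y₀ || smallNorm s.x₁ s.y₁ || smallNorm s.x₂ s.y₂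

/-- The neighbours of a vertex of `K33`. -/
def nbrs : Fin 3 ⊕ Fin 3 → List (Fin 3 ⊕ Fin 3)
  | .inl _ => [.inr 0, .inr 1, .inr 2]
  | .inr _ => [.inl 0, .inl 1, .inl 2]

/-- Every nonbacktracking continuation of length `k` that ends in `target` has nontrivial voltage. -/
def noReturn (target : Fin 3 ⊕ Fin 3) : ℕ → Fin 3 ⊕ Fin 3 → Fin 3 ⊕ Fin 3 → EisState → Bool
  | 0, _, cur, s => cur ≠ target || s.nontriv
  | k + 1, prev, cur, s => (nbrs cur).all fun t =>
      t = prev || noReturn target k cur t (s.step (arcData cur t))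

/-- Every closed nonbacktracking walk of length twelve that starts with `s₀ s₁ s₂` either returns to
`s₀` after four steps or has nontrivial voltage. -/
def search (s₀ s₁ s₂ : Fin 3 ⊕ Fin 3) : Bool :=
  (nbrs s₂).all fun s₃ => s₃ = s₁ || (nbrs s₃).all fun s₄ => s₄ = s₂ || s₄ = s₀ ||
    noReturn s₀ 8 s₃ s₄ (((((⟨0, 0, 0, 0, 0, 0, 0⟩ : EisState).step (arcData s₀ s₁)).step
      (arcData s₁ s₂)).step (arcData s₂ s₃)).step (arcData s₃ s₄))

/-- The conjunction of `search s₀ s₁ s₂` over all two-arcs that start at `s₀`. -/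
def searchFrom (s₀ : Fin 3 ⊕ Fin 3) : Bool :=
  (nbrs s₀).all fun s₁ => (nbrs s₁).all fun s₂ => s₂ = s₀ || search s₀ s₁ s₂

/-- A kernel computation over at most 3·2¹¹ walks from each vertex; it involves neither n nor r, so
it serves all moduli at once. -/
theorem searchFrom_eq_true (s₀ : Fin 3 ⊕ Fin 3) : searchFrom s₀ = true := by
  revert s₀
  decide +kernel

end Search

/-! ### Covering projection, deck transformations, connectedness -/

section Basics

instance : DecidableRel K33.Adj := fun s t =>
  inferInstanceAs (Decidable (s.isLeft ∧ t.isRight ∨ s.isRight ∧ t.isLeft))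

variable {n : ℕ} {r : ZMod n}

theorem ncg_adj {p q : (Fin 3 ⊕ Fin 3) × K n r} : (ncg n r).Adj p q ↔
    K33.Adj p.1 q.1 ∧ q.2 = p.2 * (voltage n r).volt p.1 q.1 := Iff.rfl

/-- The neighbour of a vertex of the cover over a given vertex of `K33`. -/
def next (p : (Fin 3 ⊕ Fin 3) × K n r) (t : Fin 3 ⊕ Fin 3) : (Fin 3 ⊕ Fin 3) × K n r :=
  (t, p.2 * (voltage n r).volt p.1 t)

theorem adj_next {p : (Fin 3 ⊕ Fin 3) × K n r} {t : Fin 3 ⊕ Fin 3} (h : K33.Adj p.1 t) :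
    (ncg n r).Adj p (next p t) := ⟨h, rfl⟩

theorem eq_next {p q : (Fin 3 ⊕ Fin 3) × K n r} (h : (ncg n r).Adj p q) : q = next p q.1 :=
  Prod.ext rfl h.2

theorem adj_unique {p q q' : (Fin 3 ⊕ Fin 3) × K n r} (h : (ncg n r).Adj p q)
    (h' : (ncg n r).Adj p q') (hq : q.1 = q'.1) : q = q' := by
  rw [eq_next h, eq_next h', hq]

theorem fst_ne_of_adj {p q q' : (Fin 3 ⊕ Fin 3) × K n r} (h : (ncg n r).Adj p q)
    (h' : (ncg n r).Adj q q') (hne : p ≠ q') : q'.1 ≠ p.1 :=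
  fun he => hne (adj_unique h.symm h' he.symm)

theorem neighborSet_eq (p : (Fin 3 ⊕ Fin 3) × K n r) :
    (ncg n r).neighborSet p = next p '' {t | K33.Adj p.1 t} := by
  ext q
  exact ⟨fun h => ⟨q.1, h.1, (eq_next h).symm⟩, by rintro ⟨t, ht, rfl⟩; exact adj_next ht⟩

theorem isCubic_ncg : IsCubic (ncg n r) := by
  intro p
  rw [neighborSet_eq, Set.ncard_image_of_injective _ fun s t h => congrArg Prod.fst h,
    Set.ncard_eq_toFinset_card']
  generalize p.1 = s
  revert s
  decide

variable (n r) in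
/-- Left translation by an element of the voltage group. -/
def deck : K n r →* (ncg n r ≃g ncg n r) where
  toFun k :=
    { toEquiv := (Equiv.refl _).prodCongr (Equiv.mulLeft k)
      map_rel_iff' := by
        intro p q
        simp [ncg_adj, mul_assoc] }
  map_one' := by ext p <;> simp
  map_mul' k l := by ext p <;> simp [mul_assoc]

@[simp] theorem deck_apply (k : K n r) (p : (Fin 3 ⊕ Fin 3) × K n r) :
    deck n r k p = (p.1, k * p.2) := rfl

/-- Two automorphisms that agree at a vertex and modulo the covering projection are equal,
provided the graph is connected. -/
theorem eq_one_of_fixes (hconn : (ncg n r).Connected) {f : ncg n r ≃g ncg n r}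
    (hf : ∀ p, (f p).1 = p.1) {p : (Fin 3 ⊕ Fin 3) × K n r} (hp : f p = p) : f = 1 := by
  have key : ∀ q, (ncg n r).Reachable p q → f q = q := by
    rintro q ⟨w⟩
    induction w with
    | nil => exact hp
    | cons h _ ih => exact ih (adj_unique (by simpa [hp] using f.map_adj_iff.mpr h) h (hf _))
  ext1 q
  exact key q (hconn.preconnected p q)

/-- The closed walk `s₀ s₁ s₂ s₃ s₀` in the cover. -/
theorem reachable_four (k : K n r) {s₀ s₁ s₂ s₃ : Fin 3 ⊕ Fin 3} (h₁ : K33.Adj s₀ s₁)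
    (h₂ : K33.Adj s₁ s₂) (h₃ : K33.Adj s₂ s₃) (h₄ : K33.Adj s₃ s₀) :
    (ncg n r).Reachable (s₀, k) (s₀, k * (voltage n r).volt s₀ s₁ * (voltage n r).volt s₁ s₂ *
      (voltage n r).volt s₂ s₃ * (voltage n r).volt s₃ s₀) := by
  have a₁ := adj_next (p := (s₀, k)) h₁
  have a₂ := adj_next (p := next (s₀, k) s₁) h₂
  have a₃ := adj_next (p := next (next (s₀, k) s₁) s₂) h₃
  have a₄ := adj_next (p := next (next (next (s₀, k) s₁) s₂) s₃) h₄
  exact a₁.reachable.trans (a₂.reachable.trans (a₃.reachable.trans a₄.reachable))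

/-- The voltages of closed walks at `u` form a subgroup. Four-cycles through `u` contribute `h⁻¹`,
`b⁻¹h`, `a⁻¹h` and `(hc)⁻¹`, which generate the voltage group. -/
theorem connected_ncg : (ncg n r).Connected := by
  let S : Subgroup (K n r) :=
    { carrier := {g | (ncg n r).Reachable (.inl 0, 1) (.inl 0, g)}
      one_mem' := Reachable.refl _
      mul_mem' := fun {g k} hg hk => hg.trans (by simpa using hk.map (deck n r g).toHom)
      inv_mem' := fun {g} hg => by
        have := (hg.map (deck n r g⁻¹).toHom).symm
        change (ncg n r).Reachable (_, g⁻¹ * g) (_, g⁻¹ * 1) at this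
        simpa using this }
  have hcyc : ∀ s₁ s₂ s₃ : Fin 3 ⊕ Fin 3, K33.Adj (.inl 0) s₁ → K33.Adj s₁ s₂ → K33.Adj s₂ s₃ →
      K33.Adj s₃ (.inl 0) → (voltage n r).volt (.inl 0) s₁ * (voltage n r).volt s₁ s₂ *
      (voltage n r).volt s₂ s₃ * (voltage n r).volt s₃ (.inl 0) ∈ S :=
    fun s₁ s₂ s₃ h₁ h₂ h₃ h₄ => by
      have := reachable_four (1 : K n r) h₁ h₂ h₃ h₄
      rwa [one_mul] at this
  have hh : PresentedGroup.of Gen.h ∈ S := by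
    have := hcyc (.inr 2) (.inl 1) (.inr 1) (by simp) (by simp) (by simp) (by simp)
    simpa [voltage, voltMatrix] using this
  have hb : PresentedGroup.of Gen.b ∈ S := by
    have := hcyc (.inr 0) (.inl 1) (.inr 1) (by simp) (by simp) (by simp) (by simp)
    simpa [voltage, voltMatrix, S.mul_mem_cancel_right hh] using this
  have ha : PresentedGroup.of Gen.a ∈ S := by
    have := hcyc (.inr 0) (.inl 2) (.inr 2) (by simp) (by simp) (by simp) (by simp)
    simpa [voltage, voltMatrix, S.mul_mem_cancel_right hh] using this
  have hc : PresentedGroup.of Gen.c ∈ S := by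
    have := hcyc (.inr 1) (.inl 2) (.inr 2) (by simp) (by simp) (by simp) (by simp)
    have := S.inv_mem this
    simpa [voltage, voltMatrix, S.mul_mem_cancel_left hh] using this
  have hS : S = ⊤ := by
    rw [eq_top_iff, ← PresentedGroup.closure_range_of, Subgroup.closure_le]
    rintro _ ⟨g, rfl⟩
    cases g <;> assumption
  have key : ∀ g, (ncg n r).Reachable (.inl 0, 1) (.inl 0, g) := fun g => by
    change g ∈ S
    rw [hS]; trivial
  have key' : ∀ p, (ncg n r).Reachable (.inl 0, 1) p := by
    rintro ⟨s | s, g⟩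
    · have h₁ := adj_next (p := (.inl s, g)) (t := .inr 0) (by simp)
      have h₂ := adj_next (p := next (.inl s, g) (.inr 0)) (t := .inl 0) (by simp [next])
      exact (key _).trans (h₁.reachable.trans h₂.reachable).symm
    · exact (key _).trans (adj_next (p := (.inr s, g)) (t := .inl 0) (by simp)).reachable.symm
  exact (connected_iff _).mpr ⟨fun p q => (key' p).symm.trans (key' q), ⟨(.inl 0, 1)⟩⟩

end Basics

/-! ### Automorphisms respect lifted four-cycles -/

section Lines

variable {n : ℕ} {r : ZMod n}

theorem mem_nbrs {s t : Fin 3 ⊕ Fin 3} (h : K33.Adj s t) : t ∈ nbrs s := by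
  rcases s with s | s <;> rcases t with t | t <;> simp at h <;> fin_cases t <;> simp [nbrs]

variable (r) in
/-- The value of an Eisenstein element in the model. -/
def EisState.eval (s : EisState) : Model r :=
  ⟨![s.x₀ + s.y₀ * r, s.x₁ + s.y₁ * r, s.x₂ + s.y₂ * r], (s.rot : Fin 3)⟩

/-- Multiplying `x + y r` by its conjugate `x - y - y r` gives the norm, so n would divide a
positive integer below seven. -/
theorem add_mul_ne_zero_of_smallNorm (hn : 7 ≤ n) (hr : r ^ 2 + r + 1 = 0) {x y : ℤ}
    (h : smallNorm x y = true) : (x + y * r : ZMod n) ≠ 0 := by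
  intro h0
  simp only [smallNorm, Bool.and_eq_true, decide_eq_true_eq] at h
  have : ((x * x - x * y + y * y : ℤ) : ZMod n) = 0 := by
    push_cast
    linear_combination (x - y - y * r : ZMod n) * h0 + (y : ZMod n) ^ 2 * hr
  rw [ZMod.intCast_zmod_eq_zero_iff_dvd] at this
  have := Int.le_of_dvd h.1 this
  omega

variable [hr : Fact (r ^ 2 + r + 1 = 0)]

theorem EisState.eval_ne_one (hn : 7 ≤ n) {s : EisState} (hs : s.nontriv = true) :
    s.eval r ≠ 1 := by
  intro h
  have hrot : s.rot = 0 := congrArg Model.rot h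
  have hv : ∀ i, (s.eval r).vec i = 0 := fun i => by rw [h]; rfl
  have h0 := hv 0
  have h1 := hv 1
  have h2 := hv 2
  simp only [eval, Matrix.cons_val] at h0 h1 h2
  simp only [nontriv, hrot, ne_eq, not_true_eq_false, decide_false, Bool.false_or,
    Bool.or_eq_true] at hs
  rcases hs with (hs | hs) | hs
  · exact add_mul_ne_zero_of_smallNorm hn hr.out hs h0
  · exact add_mul_ne_zero_of_smallNorm hn hr.out hs h1
  · exact add_mul_ne_zero_of_smallNorm hn hr.out hs h2

/-- The element of the model described by the data of an arc. -/
def dataModel (r : ZMod n) (d : Fin 3 × ℤ × ℤ × Fin 3) : Model r :=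
  ⟨Pi.single d.1 (d.2.1 + d.2.2.1 * r), (d.2.2.2 : Fin 3)⟩

theorem EisState.eval_step (s : EisState) (d : Fin 3 × ℤ × ℤ × Fin 3) :
    (s.step d).eval r = s.eval r * dataModel r d := by
  obtain ⟨k, x, y, j⟩ := d
  obtain ⟨x₀, y₀, x₁, y₁, x₂, y₂, i⟩ := s
  have h := hr.out
  have e0 : cubePow r (-0) = 1 := cubePow_zero
  have e1 : cubePow r (-1) = r ^ 2 := cubePow_two
  have e2 : cubePow r (-2) = r := cubePow_one
  ext1
  · ext l
    fin_cases i
    · fin_cases k <;> fin_cases l <;> simp [step, add, eval, dataModel] <;>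
        generalize hc : cubePow r _ = c <;> rw [hc.symm.trans e0] <;> ring
    · fin_cases k <;> fin_cases l <;> simp [step, add, eval, dataModel] <;>
        generalize hc : cubePow r _ = c <;> rw [hc.symm.trans e1] <;>
        linear_combination (-x - y * (r - 1) : ZMod n) * h
    · fin_cases k <;> fin_cases l <;> simp [step, add, eval, dataModel] <;>
        generalize hc : cubePow r _ = c <;> rw [hc.symm.trans e2] <;>
        linear_combination (-y : ZMod n) * h
  · fin_cases i <;> fin_cases k <;> rfl

variable [NeZero n]

theorem equivModel_volt {s t : Fin 3 ⊕ Fin 3} (h : K33.Adj s t) :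
    equivModel n r ((voltage n r).volt s t) = dataModel r (arcData s t) := by
  have e : cubePow r (-1) = -1 + -r := by
    have : cubePow r (-1) = r ^ 2 := cubePow_two
    linear_combination this + hr.out
  rcases s with s | s <;> rcases t with t | t <;> simp at h <;>
  fin_cases s <;> fin_cases t <;>
  simp [voltage, voltMatrix, arcData, dataModel, equivModel_of, genModel]
  all_goals
    ext1
    · ext l
      fin_cases l <;> simp [cubePow_zero, cubePow_one, e]
    · simp; rfl

theorem equivModel_snd {p q : (Fin 3 ⊕ Fin 3) × K n r} (h : (ncg n r).Adj p q) {g : Model r}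
    {s : EisState} (hp : equivModel n r p.2 = g * s.eval r) :
    equivModel n r q.2 = g * (s.step (arcData p.1 q.1)).eval r := by
  rw [h.2, map_mul, hp, equivModel_volt h.1, EisState.eval_step, mul_assoc]

theorem noReturn_spec (hn : 7 ≤ n) {target : Fin 3 ⊕ Fin 3} {g : Model r} (k : ℕ) (s : EisState)
    (q : ℕ → (Fin 3 ⊕ Fin 3) × K n r) (hq : ∀ i, (ncg n r).Adj (q i) (q (i + 1)))
    (hq' : ∀ i, q i ≠ q (i + 2)) (hs : equivModel n r (q 1).2 = g * s.eval r)
    (h : noReturn target k (q 0).1 (q 1).1 s = true) (ht : (q (k + 1)).1 = target) :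
    equivModel n r (q (k + 1)).2 ≠ g := by
  induction k generalizing q s with
  | zero =>
    simp only [noReturn, ne_eq, Bool.or_eq_true, decide_eq_true_eq] at h
    rw [zero_add] at ht ⊢
    rw [hs]
    simpa using EisState.eval_ne_one hn (h.resolve_left fun h => h ht)
  | succ k ih =>
    simp only [noReturn, List.all_eq_true, Bool.or_eq_true, decide_eq_true_eq] at h
    exact ih (s.step (arcData (q 1).1 (q 2).1)) (fun i => q (i + 1)) (fun i => hq (i + 1))
      (fun i => hq' (i + 1)) (equivModel_snd (hq 1) hs)
      ((h _ (mem_nbrs (hq 1).1)).resolve_left (fst_ne_of_adj (hq 0) (hq 1) (hq' 0))) ht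

/-- A closed nonbacktracking walk of length twelve projects to a walk that closes after four
steps. -/
theorem fst_four_eq (hn : 7 ≤ n) (q : ℕ → (Fin 3 ⊕ Fin 3) × K n r)
    (hq : ∀ i, (ncg n r).Adj (q i) (q (i + 1))) (hq' : ∀ i, q i ≠ q (i + 2))
    (h : q 12 = q 0) : (q 4).1 = (q 0).1 := by
  by_contra hne
  have hs := searchFrom_eq_true (q 0).1
  simp only [searchFrom, search, List.all_eq_true, Bool.or_eq_true, decide_eq_true_eq] at hs
  have hback := fun i => fst_ne_of_adj (hq i) (hq (i + 1)) (hq' i)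
  have h4 := (((((hs _ (mem_nbrs (hq 0).1) _ (mem_nbrs (hq 1).1)).resolve_left (hback 0)) _
    (mem_nbrs (hq 2).1)).resolve_left (hback 1)) _ (mem_nbrs (hq 3).1)).resolve_left
    (fun h => h.elim (hback 2) hne)
  have h0 : equivModel n r (q 0).2 = equivModel n r (q 0).2 *
      (⟨0, 0, 0, 0, 0, 0, 0⟩ : EisState).eval r := by
    rw [left_eq_mul]
    ext1
    · ext i
      fin_cases i <;> simp [EisState.eval]
    · rfl
  exact noReturn_spec hn 8 _ (fun i => q (i + 3)) (fun i => hq (i + 3)) (fun i => hq' (i + 3))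
    (equivModel_snd (hq 3) (equivModel_snd (hq 2) (equivModel_snd (hq 1)
      (equivModel_snd (hq 0) h0)))) h4 (by simp [h]) (by simp [h])

/-- The `h`-exponent of the voltage of an arc. -/
theorem rot_volt {s t : Fin 3 ⊕ Fin 3} (h : K33.Adj s t) :
    (equivModel n r ((voltage n r).volt s t)).rot = (arcData s t).2.2.2 := by
  rw [equivModel_volt h]; rfl

/-- Any two rows of the matrix of `h`-exponents differ by a vector with three distinct entries
modulo 3. -/
theorem rot_four_ne_zero {s t : Fin 3 ⊕ Fin 3} (hst : K33.Adj s t) {s' t' : Fin 3 ⊕ Fin 3}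
    (h₁ : K33.Adj t s') (h₂ : K33.Adj s' t') (h₃ : K33.Adj t' s) (hs : s ≠ s') (ht : t ≠ t') :
    (arcData s t).2.2.2 + (arcData t s').2.2.2 + (arcData s' t').2.2.2 + (arcData t' s).2.2.2 ≠
      0 := by
  rcases s with s | s <;> rcases t with t | t <;> simp at hst <;>
  rcases s' with s' | s' <;> simp at h₁ <;> rcases t' with t' | t' <;> simp at h₂ <;>
  revert s t s' t' <;> decide

/-- Automorphisms respect the relation of being the ends of a lifted four-cycle. -/
theorem map_four (hn : 7 ≤ n) (f : ncg n r ≃g ncg n r) {p₀ p₁ p₂ p₃ p₄ : (Fin 3 ⊕ Fin 3) × K n r}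
    (h₀ : (ncg n r).Adj p₀ p₁) (h₁ : (ncg n r).Adj p₁ p₂) (h₂ : (ncg n r).Adj p₂ p₃)
    (h₃ : (ncg n r).Adj p₃ p₄) (h₀₂ : p₀ ≠ p₂) (h₁₃ : p₁ ≠ p₃) (h : p₄.1 = p₀.1) :
    (f p₄).1 = (f p₀).1 := by
  -- `c` runs around the four-cycle periodically and `P` is its lift from `p₀`; `P` closes after
  -- three turns, as the voltage `T` of one turn has cube 1.
  let c : ℕ → Fin 3 ⊕ Fin 3 := fun i => ![p₀.1, p₁.1, p₂.1, p₃.1] (Fin.ofNat 4 i)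
  let P : ℕ → (Fin 3 ⊕ Fin 3) × K n r := fun i => Nat.rec p₀ (fun i p => next p (c (i + 1))) i
  have hc : ∀ i, c (i + 4) = c i := fun i => by simp [c, Fin.ofNat]
  have hP : ∀ i, (P i).1 = c i := fun i => by cases i <;> rfl
  have hadj₃ : K33.Adj p₃.1 p₀.1 := h ▸ h₃.1
  have hcadj : ∀ i, K33.Adj (c i) (c (i + 1)) ∧ c i ≠ c (i + 2) := by
    have h02 := (fst_ne_of_adj h₀ h₁ h₀₂).symm
    have h13 := (fst_ne_of_adj h₁ h₂ h₁₃).symm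
    intro i
    induction i using Nat.strong_induction_on with
    | _ i ih =>
      match i with
      | 0 => exact ⟨h₀.1, h02⟩
      | 1 => exact ⟨h₁.1, h13⟩
      | 2 => exact ⟨h₂.1, h02.symm⟩
      | 3 => exact ⟨hadj₃, h13.symm⟩
      | i + 4 =>
        have := ih i (by omega)
        rwa [hc, show i + 4 + 1 = (i + 1) + 4 by ring, show i + 4 + 2 = (i + 2) + 4 by ring, hc, hc]
  have hPadj : ∀ i, (ncg n r).Adj (P i) (P (i + 1)) := fun i =>
    adj_next (by rw [hP]; exact (hcadj i).1)
  have hPne : ∀ i, P i ≠ P (i + 2) := fun i he => (hcadj i).2 (by rw [← hP, ← hP, he])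
  have hp₁ : P 1 = p₁ := adj_unique (hPadj 0) h₀ rfl
  have hp₂ : P 2 = p₂ := adj_unique (hPadj 1) (hp₁ ▸ h₁) rfl
  have hp₃ : P 3 = p₃ := adj_unique (hPadj 2) (hp₂ ▸ h₂) rfl
  have hp₄ : P 4 = p₄ := adj_unique (hPadj 3) (hp₃ ▸ h₃) h.symm
  let T : K n r := (voltage n r).volt (c 0) (c 1) * (voltage n r).volt (c 1) (c 2) *
    (voltage n r).volt (c 2) (c 3) * (voltage n r).volt (c 3) (c 0)
  have hT : T ^ 3 = 1 := by
    apply (equivModel n r).injective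
    rw [map_pow, map_one]
    apply Model.pow_three
    simp only [T, map_mul, Model.mul_rot, rot_volt (hcadj 0).1, rot_volt (hcadj 1).1,
      rot_volt (hcadj 2).1, rot_volt (s := c 3) (t := c 0) hadj₃]
    exact rot_four_ne_zero (hcadj 0).1 (hcadj 1).1 (hcadj 2).1 hadj₃ (hcadj 0).2 (hcadj 1).2
  have hsucc : ∀ i, (P (i + 1)).2 = (P i).2 * (voltage n r).volt (c i) (c (i + 1)) := fun i => by
    rw [← hP i]; rfl
  have hP12 : P 12 = P 0 := by
    refine Prod.ext rfl ?_
    have : (P 12).2 = (P 0).2 * T ^ 3 := by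
      simp only [hsucc, pow_succ, pow_zero, one_mul, T]
      simp only [mul_assoc]
      rfl
    rw [this, hT, mul_one]
  have := fst_four_eq hn (fun i => f (P i)) (fun i => f.map_adj_iff.mpr (hPadj i))
    (fun i he => hPne i (f.injective he)) (by simp [hP12])
  rwa [hp₄] at this

end Lines

/-! ### Lifting automorphisms of K_{3,3} -/

section Lifts

variable {n : ℕ} {r : ZMod n}

/-- A map that lifts an automorphism of `K33` along the voltage assignment is an automorphism of
the cover. -/
theorem exists_lift [Finite (K n r)] (σ : K33 ≃g K33) (θ : K n r →* K n r)
    (κ : Fin 3 ⊕ Fin 3 → K n r)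
    (h : ∀ i j, θ (voltMatrix n r i j) =
      κ (.inl i) * (voltage n r).volt (σ (.inl i)) (σ (.inr j)) * (κ (.inr j))⁻¹) :
    ∃ f : ncg n r ≃g ncg n r, ∀ p, f p = (σ p.1, θ p.2 * κ p.1) := by
  let F : (Fin 3 ⊕ Fin 3) × K n r → (Fin 3 ⊕ Fin 3) × K n r := fun p => (σ p.1, θ p.2 * κ p.1)
  have hvolt : ∀ s t, K33.Adj s t →
      θ ((voltage n r).volt s t) * κ t = κ s * (voltage n r).volt (σ s) (σ t) := by
    rintro (s | s) (t | t) hst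
    · simp at hst
    · exact (congrArg (· * κ (.inr t)) (h s t)).trans (inv_mul_cancel_right _ _)
    · have hinv : (voltage n r).volt (.inr s) (.inl t) = (voltMatrix n r t s)⁻¹ := rfl
      rw [hinv, map_inv, h t s, (voltage n r).volt_symm (σ (.inr s)) _ (σ.map_adj_iff.mpr hst)]
      group
    · simp at hst
  have hF : ∀ p q, (ncg n r).Adj p q → (ncg n r).Adj (F p) (F q) := by
    intro p q hpq
    refine ⟨σ.map_adj_iff.mpr hpq.1, ?_⟩
    change θ q.2 * κ q.1 = θ p.2 * κ p.1 * _
    rw [hpq.2, map_mul, mul_assoc, hvolt _ _ hpq.1, mul_assoc]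
  -- The range of `F` is closed under adjacency, hence everything by connectedness. Finiteness then
  -- gives injectivity, so `θ` need not be assumed invertible.
  have hsurj : Function.Surjective F := by
    have key : ∀ p q, (ncg n r).Adj p q → p ∈ Set.range F → q ∈ Set.range F := by
      rintro _ q hq ⟨p, rfl⟩
      have hpq : K33.Adj p.1 (σ.symm q.1) := by
        rw [← σ.map_adj_iff, σ.apply_symm_apply]
        exact hq.1
      exact ⟨next p (σ.symm q.1), adj_unique (hF _ _ (adj_next hpq)) hq (σ.apply_symm_apply _)⟩
    intro q
    obtain ⟨w⟩ := connected_ncg.preconnected (F (.inl 0, 1)) q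
    have : ∀ p q, (ncg n r).Walk p q → p ∈ Set.range F → q ∈ Set.range F := by
      intro p q w
      induction w with
      | nil => exact id
      | cons h _ ih => exact fun hp => ih (key _ _ h hp)
    exact this _ _ w ⟨_, rfl⟩
  have hbij : Function.Bijective F := ⟨Finite.injective_iff_surjective.mpr hsurj, hsurj⟩
  refine ⟨⟨Equiv.ofBijective F hbij, fun {p q} => ⟨fun hpq => ?_, hF p q⟩⟩, fun p => rfl⟩
  have h1 : K33.Adj p.1 q.1 := σ.map_adj_iff.mp hpq.1
  have h2 : F (next p q.1) = F q := adj_unique (hF _ _ (adj_next h1)) hpq rfl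
  rw [← hbij.1 h2]
  exact adj_next h1

variable [NeZero n] [hr : Fact (r ^ 2 + r + 1 = 0)]

/-- The form of `exists_lift` in which all computations take place in the model. -/
theorem exists_lift_of_model (σ : K33 ≃g K33) (F : Gen → Model r)
    (ha : (F .a).rot = 0) (hb : (F .b).rot = 0) (hc : (F .c).rot = 0) (hh : (F .h).rot = 1)
    (κ : Fin 3 ⊕ Fin 3 → Model r)
    (h : ∀ i j, PresentedGroup.toGroup (lift_rels ha hb hc hh) (voltMatrix n r i j) =
      κ (.inl i) * equivModel n r ((voltage n r).volt (σ (.inl i)) (σ (.inr j))) *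
        (κ (.inr j))⁻¹) :
    ∃ f : ncg n r ≃g ncg n r, (∀ p, (f p).1 = σ p.1) ∧
      ∀ s, (f (s, 1)).2 = (equivModel n r).symm (κ s) := by
  obtain ⟨f, hf⟩ := exists_lift σ ((equivModel n r).symm.toMonoidHom.comp
    (PresentedGroup.toGroup (lift_rels ha hb hc hh))) (fun s => (equivModel n r).symm (κ s))
    (fun i j => by
      rw [MonoidHom.comp_apply, h]
      simp)
  exact ⟨f, fun p => by rw [hf], fun s => by simp [hf]⟩

/-- The automorphism of `K33` that rotates `u, v, w`. -/
def rotate : K33 ≃g K33 where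
  toFun
    | .inl i => .inl (i + 1)
    | .inr j => .inr j
  invFun
    | .inl i => .inl (i - 1)
    | .inr j => .inr j
  left_inv := by rintro (i | i) <;> simp
  right_inv := by rintro (i | i) <;> simp
  map_rel_iff' := by rintro (i | i) (j | j) <;> simp

/-- The automorphism `u ↦ x ↦ u`, `v ↦ z ↦ w ↦ y ↦ v` of `K33`. -/
def turn : K33 ≃g K33 where
  toFun
    | .inl i => .inr (-i)
    | .inr j => .inl j
  invFun
    | .inl i => .inr i
    | .inr j => .inl (-j)
  left_inv := by rintro (i | i) <;> simp
  right_inv := by rintro (i | i) <;> simp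
  map_rel_iff' := by rintro (i | i) (j | j) <;> simp

variable (n r)

theorem exists_lift_rotate : ∃ f : ncg n r ≃g ncg n r, ∀ p, (f p).1 = rotate p.1 := by
  have h := hr.out
  have e0 : cubePow r 0 = 1 := cubePow_zero
  have e1 : cubePow r 1 = r := cubePow_one
  have e2 : cubePow r 2 = -1 - r := by rw [cubePow_two]; linear_combination h
  have e3 : cubePow r (-1) = -1 - r := e2
  have e4 : cubePow r (-2) = r := e1
  have e5 : cubePow r (1 + -2) = -1 - r := e2
  obtain ⟨f, hf, -⟩ := exists_lift_of_model (n := n) (r := r) rotate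
    -- Put `κ u = 1`. The arcs of trivial voltage form a spanning tree and determine `κ`; the other
    -- four arcs then determine the images of the generators.
    (fun
      | .a => ⟨![0, -r, -1], 0⟩
      | .b => ⟨![r, -r, r], 0⟩
      | .c => ⟨![0, 0, r], 0⟩
      | .h => ⟨![0, 0, -1], 1⟩) rfl rfl rfl rfl
    (Sum.elim ![1, ⟨![0, 0, -1], 2⟩, ⟨0, 1⟩] ![⟨![0, r, 0], 2⟩, 1, ⟨0, 1⟩]) (by
      intro i j
      fin_cases i <;> fin_cases j <;>
      simp [voltMatrix, rotate, voltage, PresentedGroup.toGroup.of, equivModel_of, genModel]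
      all_goals
        ext1
        · ext l
          fin_cases l <;> simp [e1, e2, e3, e4, e5]
          all_goals grind
        · simp; try rfl)
  exact ⟨f, hf⟩

theorem exists_lift_turn : ∃ f : ncg n r ≃g ncg n r, (∀ p, (f p).1 = turn p.1) ∧
    f (.inl 0, 1) = (.inr 0, 1) ∧ f (.inr 0, 1) = (.inl 0, 1) := by
  have h := hr.out
  have e0 : cubePow r 0 = 1 := cubePow_zero
  have e1 : cubePow r 1 = r := cubePow_one
  have e2 : cubePow r 2 = -1 - r := by rw [cubePow_two]; linear_combination h
  have e3 : cubePow r (-1) = -1 - r := e2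
  have e4 : cubePow r (-2) = r := e1
  have e5 : cubePow r (1 + -2) = -1 - r := e2
  obtain ⟨f, hf, hf'⟩ := exists_lift_of_model (n := n) (r := r) turn
    -- The constants come from the same spanning tree, again with `κ u = 1`.
    (fun
      | .a => ⟨![0, -1, 1], 0⟩
      | .b => ⟨![-1 - r, r, 0], 0⟩
      | .c => ⟨![-1 - r, 1 + r, -1 - r], 0⟩
      | .h => ⟨![-1 - r, -1, 0], 1⟩) rfl rfl rfl rfl
    (Sum.elim ![1, ⟨![0, -1, 0], 2⟩, ⟨![-1, 0, r], 2⟩] ![1, ⟨![0, -1, 0], 1⟩, ⟨![-1, 0, 0], 1⟩]) (by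
      intro i j
      fin_cases i <;> fin_cases j <;>
      simp [voltMatrix, turn, voltage, PresentedGroup.toGroup.of, equivModel_of, genModel]
      all_goals
        ext1
        · ext l
          fin_cases l <;> simp [e0, e1, e3, e4, e5]
          all_goals grind
        · simp; try rfl)
  exact ⟨f, hf, Prod.ext (by rw [hf]; rfl) (by simp [hf']), Prod.ext (by rw [hf]; rfl) (by simp [hf'])⟩

end Lifts

/-! ### Automorphisms permute the fibres -/

section Projection

variable {n : ℕ} {r : ZMod n}

/-- A vertex of the cover on the side of `K33` that does not contain the given vertex. -/
def oppositeBase (n : ℕ) (r : ZMod n) : Fin 3 ⊕ Fin 3 → (Fin 3 ⊕ Fin 3) × K n r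
  | .inl _ => (.inr 0, 1)
  | .inr _ => (.inl 0, 1)

theorem adj_oppositeBase (t : Fin 3 ⊕ Fin 3) : K33.Adj (oppositeBase n r t).1 t := by
  cases t <;> simp [oppositeBase]

/-- If `p` and `p'` are at distance two, their neighbours over a common `t` are equal or are the
ends of a lifted four-cycle, so `f` sends them to one fibre. Connectedness spreads this over each of
the two sides of the bipartition. -/
theorem exists_fst_eq (f : ncg n r ≃g ncg n r)
    (hf : ∀ {p₀ p₁ p₂ p₃ p₄ : (Fin 3 ⊕ Fin 3) × K n r}, (ncg n r).Adj p₀ p₁ →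
      (ncg n r).Adj p₁ p₂ → (ncg n r).Adj p₂ p₃ → (ncg n r).Adj p₃ p₄ → p₀ ≠ p₂ → p₁ ≠ p₃ →
      p₄.1 = p₀.1 → (f p₄).1 = (f p₀).1) :
    ∃ σ : Fin 3 ⊕ Fin 3 → Fin 3 ⊕ Fin 3, ∀ p, (f p).1 = σ p.1 := by
  let A : (Fin 3 ⊕ Fin 3) × K n r → Prop := fun p => ∀ t, K33.Adj p.1 t →
    (f (next p t)).1 = (f (next (oppositeBase n r t) t)).1
  have hdist : ∀ p q p' t, (ncg n r).Adj p q → (ncg n r).Adj q p' → K33.Adj p.1 t →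
      K33.Adj p'.1 t → (f (next p t)).1 = (f (next p' t)).1 := by
    intro p q p' t hpq hqp' ht ht'
    by_cases hpp : p = p'
    · rw [hpp]
    by_cases hq : q.1 = t
    · rw [adj_unique (adj_next ht) hpq hq.symm, adj_unique (adj_next ht') hqp'.symm hq.symm]
    exact (hf (adj_next ht).symm hpq hqp' (adj_next ht')
      (fun h => hq (congrArg Prod.fst h).symm) hpp rfl).symm
  have hA : ∀ p q p', (ncg n r).Adj p q → (ncg n r).Adj q p' → A p → A p' := by
    intro p q p' hpq hqp' hp t ht
    have ht' : K33.Adj p.1 t := by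
      have h₁ := hpq.1
      have h₂ := hqp'.1
      generalize p.1 = s, q.1 = s', p'.1 = s'' at *
      rcases s with s | s <;> rcases s' with s' | s' <;> rcases s'' with s'' | s'' <;>
        rcases t with t | t <;> simp at h₁ h₂ ht ⊢
    rw [← hdist p q p' t hpq hqp' ht' ht, hp t ht']
  have h₀ : A (.inl 0, 1) := by
    rintro (t | t) ht
    · simp at ht
    · rfl
  have h₁ : A (.inr 0, 1) := by
    rintro (t | t) ht
    · rfl
    · simp at ht
  have h₀₁ : (ncg n r).Adj (.inl 0, 1) (.inr 0, 1) := by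
    simp [ncg_adj, voltage, voltMatrix]
  have key : ∀ p q, (ncg n r).Walk p q → (A p ∧ ∀ p', (ncg n r).Adj p p' → A p') → A q := by
    intro p q w
    induction w with
    | nil => exact And.left
    | cons h _ ih => exact fun hp => ih ⟨hp.2 _ h, fun p' hp' => hA _ _ _ h hp' hp.1⟩
  have hall : ∀ q, A q := fun q => by
    obtain ⟨w⟩ := connected_ncg.preconnected (.inl 0, 1) q
    exact key _ q w ⟨h₀, fun p' hp' => hA _ _ _ h₀₁.symm hp' h₁⟩
  refine ⟨fun t => (f (next (oppositeBase n r t) t)).1, fun q => ?_⟩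
  have hadj : K33.Adj q.1 (oppositeBase n r q.1).1 := (adj_oppositeBase q.1).symm
  have := hall (next q (oppositeBase n r q.1).1) q.1 hadj.symm
  rwa [← eq_next (adj_next hadj).symm] at this

theorem proj_unique {f : ncg n r ≃g ncg n r} {σ τ : K33 ≃g K33} (hσ : ∀ p, (f p).1 = σ p.1)
    (hτ : ∀ p, (f p).1 = τ p.1) : σ = τ := by
  ext1 s
  exact (hσ (s, 1)).symm.trans (hτ (s, 1))

variable [NeZero n] [hr : Fact (r ^ 2 + r + 1 = 0)]

/-- Every automorphism of the cover is a lift of an automorphism of `K33`. -/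
theorem exists_proj (hn : 7 ≤ n) (f : ncg n r ≃g ncg n r) :
    ∃ σ : K33 ≃g K33, ∀ p, (f p).1 = σ p.1 := by
  have hfun : ∀ f : ncg n r ≃g ncg n r, ∃ σ : Fin 3 ⊕ Fin 3 → Fin 3 ⊕ Fin 3,
      (∀ p, (f p).1 = σ p.1) ∧ ∀ s t, K33.Adj s t → K33.Adj (σ s) (σ t) := by
    intro f
    obtain ⟨σ, hσ⟩ := exists_fst_eq f (map_four hn f)
    refine ⟨σ, hσ, fun s t hst => ?_⟩
    have := (f.map_adj_iff.mpr (adj_next (p := ((s, 1) : _ × K n r)) hst)).1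
    rwa [hσ, hσ] at this
  obtain ⟨σ, hσ, hadj⟩ := hfun f
  obtain ⟨τ, hτ, hadj'⟩ := hfun f.symm
  have h1 : ∀ s, τ (σ s) = s := fun s => by
    rw [show s = ((s, 1) : _ × K n r).1 from rfl, ← hσ, ← hτ, f.symm_apply_apply]
  have h2 : ∀ s, σ (τ s) = s := fun s => by
    rw [show s = ((s, 1) : _ × K n r).1 from rfl, ← hτ, ← hσ, f.apply_symm_apply]
  exact ⟨⟨⟨σ, τ, h1, h2⟩, fun {s t} => ⟨fun h => by simpa [h1] using hadj' _ _ h, hadj s t⟩⟩, hσ⟩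

/-- The homomorphism from the automorphism group of the cover to that of `K33`. -/
noncomputable def projHom (hn : 7 ≤ n) : (ncg n r ≃g ncg n r) →* (K33 ≃g K33) where
  toFun f := (exists_proj hn f).choose
  map_one' := proj_unique (f := 1) (exists_proj hn 1).choose_spec fun _ => rfl
  map_mul' f g := proj_unique (exists_proj hn (f * g)).choose_spec fun p => by
    rw [RelIso.mul_apply, RelIso.mul_apply, (exists_proj hn f).choose_spec,
      (exists_proj hn g).choose_spec]

theorem projHom_apply (hn : 7 ≤ n) (f : ncg n r ≃g ncg n r) (p : (Fin 3 ⊕ Fin 3) × K n r) :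
    (f p).1 = projHom hn f p.1 := (exists_proj hn f).choose_spec p

end Projection

/-! ### Solvability of the automorphism group -/

section Solvable

instance : Group.IsSolvable (Equiv.Perm (Fin 3)) := by
  have : Group.IsSolvable (alternatingGroup (Fin 3)) :=
    Group.isSolvable_of_comm (by decide)
  exact Group.isSolvable_of_ker_le_range (alternatingGroup (Fin 3)).subtype Equiv.Perm.sign
    (by rw [Subgroup.range_subtype]; rfl)

/-- The side-preserving automorphisms of `K33`. -/
def sidesHom : Equiv.Perm (Fin 3) × Equiv.Perm (Fin 3) →* (K33 ≃g K33) where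
  toFun α := ⟨Equiv.sumCongr α.1 α.2, by rintro (i | i) (j | j) <;> simp⟩
  map_one' := by ext1 (i | i) <;> rfl
  map_mul' _ _ := by ext1 (i | i) <;> rfl

theorem isLeft_apply_eq_iff (σ : K33 ≃g K33) (s t : Fin 3 ⊕ Fin 3) :
    (σ s).isLeft = (σ t).isLeft ↔ s.isLeft = t.isLeft := by
  have h : ∀ s t, K33.Adj s t ↔ s.isLeft ≠ t.isLeft := by
    rintro (s | s) (t | t) <;> simp
  have := σ.map_adj_iff (v := s) (w := t)
  rw [h, h] at this
  exact not_iff_not.mp this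

/-- The action of the automorphisms of `K33` on the two sides. -/
def sideAction : (K33 ≃g K33) →* ℤˣ where
  toFun σ := if (σ (.inl 0)).isLeft then 1 else -1
  map_one' := rfl
  map_mul' σ τ := by
    have := isLeft_apply_eq_iff σ (τ (.inl 0)) (.inl 0)
    rw [RelIso.mul_apply]
    cases h₁ : (σ (.inl 0)).isLeft <;> cases h₂ : (τ (.inl 0)).isLeft <;> simp_all

instance : Group.IsSolvable (K33 ≃g K33) := by
  refine Group.isSolvable_of_ker_le_range sidesHom sideAction fun σ hσ => ?_
  have h0 : (σ (.inl 0)).isLeft = true := by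
    by_contra h
    have : sideAction σ = -1 := if_neg h
    rw [MonoidHom.mem_ker.mp hσ] at this
    exact absurd this (by decide)
  have hmaps : Set.MapsTo σ.toEquiv (Set.range Sum.inl) (Set.range Sum.inl) := by
    rintro _ ⟨i, rfl⟩
    have := (isLeft_apply_eq_iff σ (.inl i) (.inl 0)).mpr rfl
    rw [h0] at this
    obtain ⟨j, hj⟩ := Sum.isLeft_iff.mp this
    exact ⟨j, hj.symm⟩
  obtain ⟨α, hα⟩ := Equiv.Perm.mem_sumCongrHom_range_of_perm_mapsTo_inl hmaps
  exact ⟨α, RelIso.ext fun s => congrArg (fun e : Equiv.Perm (Fin 3 ⊕ Fin 3) => e s) hα⟩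

variable {n : ℕ} {r : ZMod n} [NeZero n] [hr : Fact (r ^ 2 + r + 1 = 0)]

/-- An automorphism that fixes every fibre agrees with a deck transformation at one vertex, hence
everywhere. -/
theorem isSolvable_aut (hn : 7 ≤ n) : Group.IsSolvable (ncg n r ≃g ncg n r) := by
  refine Group.isSolvable_of_ker_le_range (deck n r) (projHom hn) fun f hf => ?_
  have hproj : ∀ p, (f p).1 = p.1 := fun p => by
    rw [projHom_apply hn, MonoidHom.mem_ker.mp hf]; rfl
  refine ⟨(f (.inl 0, 1)).2, ?_⟩
  rw [← inv_mul_eq_one, ← map_inv]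
  exact eq_one_of_fixes connected_ncg (fun p => hproj p) (p := (.inl 0, 1))
    (Prod.ext (hproj _) (inv_mul_cancel _))

end Solvable

/-! ### Transitivity on two-arcs -/

section TwoArcs

variable {n : ℕ} {r : ZMod n}

/-- `rotate` and its conjugate by `turn` rotate the two sides independently, and `turn` has order
four: 3·3·4 words for 36 two-arcs. -/
theorem exists_word : ∀ s₀ s₁ s₂ : Fin 3 ⊕ Fin 3, K33.Adj s₀ s₁ → K33.Adj s₁ s₂ → s₀ ≠ s₂ →
    ∃ i j k : Fin 4, ∀ σ : K33 ≃g K33,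
      σ = rotate ^ i.val * (turn * rotate * turn⁻¹) ^ j.val * turn ^ k.val →
      σ (.inl 0) = s₀ ∧ σ (.inr 0) = s₁ ∧ σ (.inl 1) = s₂ := by
  simp only [forall_eq]
  decide +kernel

variable [NeZero n] [hr : Fact (r ^ 2 + r + 1 = 0)]

variable (n r) in
/-- The automorphisms of `K33` that lift to the cover. -/
def liftable : Subgroup (K33 ≃g K33) where
  carrier := {σ | ∃ f : ncg n r ≃g ncg n r, ∀ p, (f p).1 = σ p.1}
  one_mem' := ⟨1, fun _ => rfl⟩
  mul_mem' := by
    rintro σ τ ⟨f, hf⟩ ⟨g, hg⟩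
    exact ⟨f * g, fun p => by rw [RelIso.mul_apply, hf, hg]; rfl⟩
  inv_mem' := by
    rintro σ ⟨f, hf⟩
    refine ⟨f⁻¹, fun p => σ.injective ?_⟩
    rw [← hf, RelIso.apply_inv_self, RelIso.apply_inv_self]

theorem exists_map_two_arc {p q w : (Fin 3 ⊕ Fin 3) × K n r} (hpq : (ncg n r).Adj p q)
    (hqw : (ncg n r).Adj q w) (hpw : p ≠ w) : ∃ f : ncg n r ≃g ncg n r, f (.inl 0, 1) = p ∧
      f (.inr 0, 1) = q ∧ f (next (.inr 0, 1) (.inl 1)) = w := by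
  have h₀₁ : (ncg n r).Adj (.inl 0, 1) (.inr 0, 1) := by
    simp [ncg_adj, voltage, voltMatrix]
  have h₁₂ : (ncg n r).Adj (.inr 0, 1) (next (.inr 0, 1) (.inl 1)) := adj_next (by simp)
  obtain ⟨i, j, k, hσ⟩ := exists_word p.1 q.1 w.1 hpq.1 hqw.1 (fst_ne_of_adj hpq hqw hpw).symm
  obtain ⟨h0, h1, h2⟩ := hσ _ rfl
  have hrot : rotate ∈ liftable n r := exists_lift_rotate n r
  have hturn : turn ∈ liftable n r := (exists_lift_turn n r).imp fun f hf => hf.1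
  obtain ⟨f, hf⟩ := (liftable n r).mul_mem ((liftable n r).mul_mem
    ((liftable n r).pow_mem hrot i.val) ((liftable n r).pow_mem ((liftable n r).mul_mem
      ((liftable n r).mul_mem hturn hrot) ((liftable n r).inv_mem hturn)) j.val))
    ((liftable n r).pow_mem hturn k.val)
  -- The lift `f` is right modulo the projection; the deck transformation corrects the first vertex,
  -- and unique path lifting the other two.
  let g := deck n r (p.2 * (f (.inl 0, 1)).2⁻¹) * f
  have hg : ∀ x, (g x).1 = (f x).1 := fun x => rfl
  have e0 : g (.inl 0, 1) = p :=
    Prod.ext (by rw [hg, hf, h0]) (inv_mul_cancel_right _ _)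
  have e1 : g (.inr 0, 1) = q :=
    adj_unique (e0 ▸ g.map_adj_iff.mpr h₀₁) hpq (by rw [hg, hf, h1])
  exact ⟨g, e0, e1, adj_unique (e1 ▸ g.map_adj_iff.mpr h₁₂) hqw (by rw [hg, hf]; exact h2)⟩

end TwoArcs

/-! ### Edge-reversing involutions of cubic Cayley graphs -/

section CayleyGraphs

universe u

variable {V : Type u} {Γ : SimpleGraph V}

theorem mulCayley_adj_one {G : Type*} [Group G] {S : Set G} (h1 : (1 : G) ∉ S)
    (hinv : ∀ g ∈ S, g⁻¹ ∈ S) (x : G) : (mulCayley S).Adj 1 x ↔ x ∈ S := by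
  rw [mulCayley_adj']
  constructor
  · rintro ⟨-, g, hg, h | h⟩
    · rwa [← h, one_mul]
    · rw [eq_inv_of_mul_eq_one_left h.symm]
      exact hinv g hg
  · exact fun hx => ⟨fun h => h1 (h ▸ hx), x, hx, Or.inl (one_mul x)⟩

/-- A left translation is an automorphism of the Cayley graph. -/
def mulLeftIso {G : Type*} [Group G] (S : Set G) (g : G) : mulCayley S ≃g mulCayley S where
  toEquiv := Equiv.mulLeft g
  map_rel_iff' := by
    intro x y
    simp [mulCayley_adj', mul_assoc]

/-- Inversion is an involution of a set of odd size, so it has a fixed point. -/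
theorem exists_inv_eq_self {G : Type*} [Group G] {S : Set G} (hinv : ∀ g ∈ S, g⁻¹ ∈ S)
    (hcard : S.ncard = 3) : ∃ s ∈ S, s⁻¹ = s := by
  obtain ⟨x, y, z, hxy, hxz, hyz, rfl⟩ := Set.ncard_eq_three.mp hcard
  have hx := hinv x (by simp)
  have hy := hinv y (by simp)
  have hz := hinv z (by simp)
  simp only [Set.mem_insert_iff, Set.mem_singleton_iff, exists_eq_or_imp, exists_eq_left]
    at hx hy hz ⊢
  rcases hx with hx | hx | hx
  · exact Or.inl hx
  · right; right
    rcases hz with hz | hz | hz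
    · exact (hyz (by rw [← hx, ← hz, inv_inv])).elim
    · exact (hxz (by rw [← inv_inv z, hz, ← hx, inv_inv])).elim
    · exact hz
  · right; left
    rcases hy with hy | hy | hy
    · exact (hyz (by rw [← hx, ← hy, inv_inv])).elim
    · exact hy
    · exact (hxy (by rw [← inv_inv y, hy, ← hx, inv_inv])).elim

/-- A cubic Cayley graph has an involutory automorphism that reverses an edge. -/
theorem exists_reversing_of_isCayley (hΓ : IsCubic Γ) (h : IsCayley Γ) :
    ∃ f : Γ ≃g Γ, orderOf f = 2 ∧ ∃ x y : V, Γ.Adj x y ∧ f x = y ∧ f y = x := by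
  obtain ⟨G, _, S, h1, hinv, ⟨ψ⟩⟩ := h
  have hcard : S.ncard = 3 := by
    rw [← hΓ (ψ.symm 1), ← Set.ncard_image_of_injective _ ψ.symm.injective]
    congr 1
    ext v
    rw [mem_neighborSet, ← ψ.map_adj_iff, ψ.apply_symm_apply, mulCayley_adj_one h1 hinv]
    exact ⟨by rintro ⟨x, hx, rfl⟩; simpa using hx, fun hv => ⟨_, hv, ψ.symm_apply_apply v⟩⟩
  obtain ⟨s, hs, hss⟩ := exists_inv_eq_self hinv hcard
  have hmul : s * s = 1 := by rw [← inv_mul_cancel s, hss]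
  have hadj : Γ.Adj (ψ.symm 1) (ψ.symm s) := by
    rw [← ψ.map_adj_iff, ψ.apply_symm_apply, ψ.apply_symm_apply, mulCayley_adj_one h1 hinv]
    exact hs
  -- Left translation by the involution `s` exchanges the adjacent vertices `1` and `s`.
  let f : Γ ≃g Γ := (ψ.trans (mulLeftIso S s)).trans ψ.symm
  have hf : ∀ x, f x = ψ.symm (s * ψ x) := fun _ => rfl
  refine ⟨f, orderOf_eq_prime ?_ fun h => ?_, _, _, hadj, by simp [hf], by simp [hf, hmul]⟩
  · ext x
    simp [pow_two, RelIso.mul_apply, hf, ← mul_assoc, hmul]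
  · have : f (ψ.symm 1) = ψ.symm 1 := by rw [h]; rfl
    rw [hf, ψ.apply_symm_apply, mul_one] at this
    exact hadj.ne this.symm

end CayleyGraphs

/-! ### Semiregularity on two-arcs -/

section Semiregular

variable {n : ℕ} {r : ZMod n}

theorem map_next {f : ncg n r ≃g ncg n r} {σ : K33 ≃g K33} (hσ : ∀ p, (f p).1 = σ p.1)
    {p : (Fin 3 ⊕ Fin 3) × K n r} {t : Fin 3 ⊕ Fin 3} (h : K33.Adj p.1 t) :
    f (next p t) = next (f p) (σ t) := by
  rw [eq_next (f.map_adj_iff.mpr (adj_next h)), hσ (next p t)]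
  rfl

variable [hr : Fact (r ^ 2 + r + 1 = 0)]

/-- `(1 + 2r)² = -3`, so vanishing would make n a divisor of 3. -/
theorem one_add_two_mul_ne_zero (hn : 7 ≤ n) : 1 + 2 * r ≠ 0 := by
  intro h
  have h3 : ((3 : ℕ) : ZMod n) = 0 := by
    push_cast
    linear_combination 4 * hr.out - (1 + 2 * r) * h
  rw [ZMod.natCast_eq_zero_iff] at h3
  have := Nat.le_of_dvd (by norm_num) h3
  omega

variable [NeZero n]

/-- The transposition of two vertices of `K33` does not lift to the cover. -/
theorem not_lift_transposition (hn : 7 ≤ n) {f : ncg n r ≃g ncg n r} {σ : K33 ≃g K33}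
    (hσ : ∀ p, (f p).1 = σ p.1) (h1 : f (.inl 0, 1) = (.inl 0, 1)) (hu : σ (.inl 0) = .inl 0)
    (hv : σ (.inl 1) = .inl 1) (hx : σ (.inr 0) = .inr 0) (hy : σ (.inr 1) = .inr 2)
    (hz : σ (.inr 2) = .inr 1) : False := by
  obtain ⟨F, hF⟩ : ∃ F : K n r → K n r, ∀ g, f (.inl 0, g) = (.inl 0, F g) :=
    ⟨fun g => (f (.inl 0, g)).2, fun g => Prod.ext ((hσ _).trans hu) rfl⟩
  have hF1 : F 1 = 1 := congrArg Prod.snd ((hF 1).symm.trans h1)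
  set h : K n r := PresentedGroup.of Gen.h with hh
  set b : K n r := PresentedGroup.of Gen.b with hb
  have hcyc : ∀ g s₁ s₂ s₃, K33.Adj (.inl 0) s₁ → K33.Adj s₁ s₂ → K33.Adj s₂ s₃ →
      K33.Adj s₃ (.inl 0) → (.inl 0, F (next (next (next (next (.inl 0, g) s₁) s₂) s₃) (.inl 0)).2) =
      next (next (next (next (.inl 0, F g) (σ s₁)) (σ s₂)) (σ s₃)) (.inl 0) := by
    intro g s₁ s₂ s₃ a₁ a₂ a₃ a₄
    have e := map_next hσ (p := next (next (next (.inl 0, g) s₁) s₂) s₃) a₄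
    rw [map_next hσ (p := next (next (.inl 0, g) s₁) s₂) a₃,
      map_next hσ (p := next (.inl 0, g) s₁) a₂, map_next hσ (p := (.inl 0, g)) a₁, hF, hu] at e
    exact (hF _).symm.trans e
  -- The cycle `u z v y`, of voltage `h⁻¹`, goes to `u y v z`, of voltage `h`. Below, `u x v y` goes
  -- to `u x v z`. Together they show that `F` inverts `h` and keeps `b⁻¹`.
  have hFh : ∀ g, F (g * h⁻¹) = F g * h := by
    intro g
    have := congrArg Prod.snd (hcyc g (.inr 2) (.inl 1) (.inr 1) (by simp) (by simp) (by simp)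
      (by simp))
    simpa [next, hy, hz, hv, voltage, voltMatrix] using this
  have hFbh : ∀ g, F (g * (b⁻¹ * h)) = F g * (b⁻¹ * h) * h := by
    intro g
    have := congrArg Prod.snd (hcyc g (.inr 0) (.inl 1) (.inr 1) (by simp) (by simp) (by simp)
      (by simp))
    simpa [next, hx, hy, hz, hv, voltage, voltMatrix] using this
  have hFb : ∀ g, F (g * b⁻¹) = F g * b⁻¹ := by
    intro g
    rw [show g * b⁻¹ = g * (b⁻¹ * h) * h⁻¹ by group, hFh, hFbh, mul_assoc, mul_assoc,
      show b⁻¹ * h * (h * h) = b⁻¹ * h ^ 3 by simp only [pow_succ, pow_zero, one_mul, mul_assoc], h_pow_three, mul_one]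
  have hFbk : ∀ k : ℕ, F (b⁻¹ ^ k) = b⁻¹ ^ k := by
    intro k
    induction k with
    | zero => simpa using hF1
    | succ k ih => rw [pow_succ, hFb, ih]
  have hrel : h⁻¹ * b⁻¹ = b⁻¹ ^ r.val * h⁻¹ := by
    have hconj : h⁻¹ * b * h = b ^ r.val := gen_conj (by simp)
    rw [inv_pow, ← hconj]
    group
  -- Applying `F` to `hrel` replaces `h⁻¹` by `h`. Conjugation by `h` and by `h⁻¹` then agree on
  -- `b`, so `r² = r` and `1 + 2r = 0`.
  have key : h * b⁻¹ = b⁻¹ ^ r.val * h := by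
    rw [← hFbk, ← hFh, ← hrel, hFb, ← one_mul h⁻¹, hFh, hF1, one_mul]
  have := congrArg (fun x => (equivModel n r x).vec 1) key
  have e : cubePow r (-1) = r ^ 2 := cubePow_two
  simp only [map_mul, map_pow, map_inv, hh, hb, equivModel_of, genModel] at this
  rw [show (⟨![0, 1, 0], 0⟩ : Model r)⁻¹ = ⟨-![0, 1, 0], 0⟩ by ext1 <;> simp [cubePow_zero],
    Model.mk_pow] at this
  simp [e] at this
  exact one_add_two_mul_ne_zero hn (by linear_combination -this + hr.out)

/-- The projection fixes `u`, `x`, `v` and hence `w`, so it is the identity or swaps `y` and `z`;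
the swap does not lift. -/
theorem eq_one_of_fixes_base (hn : 7 ≤ n) {f : ncg n r ≃g ncg n r}
    (h0 : f (.inl 0, 1) = (.inl 0, 1)) (h1 : f (.inr 0, 1) = (.inr 0, 1))
    (h2 : f (next (.inr 0, 1) (.inl 1)) = next (.inr 0, 1) (.inl 1)) : f = 1 := by
  obtain ⟨σ, hσ⟩ := exists_proj hn f
  have hu : σ (.inl 0) = .inl 0 := by rw [← hσ (.inl 0, 1), h0]
  have hx : σ (.inr 0) = .inr 0 := by rw [← hσ (.inr 0, 1), h1]
  have hv : σ (.inl 1) = .inl 1 := by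
    rw [show (.inl 1 : Fin 3 ⊕ Fin 3) = (next ((.inr 0, 1) : _ × K n r) (.inl 1)).1 from rfl,
      ← hσ, h2]
  have hside : ∀ i, ∃ j, σ (.inr i) = .inr j := fun i => by
    have := σ.map_adj_iff.mpr (show K33.Adj (.inl 0) (.inr i) by simp)
    rw [hu] at this
    cases h : σ (.inr i) <;> simp [h] at this ⊢
  have hside' : ∀ i, ∃ j, σ (.inl i) = .inl j := fun i => by
    have := σ.map_adj_iff.mpr (show K33.Adj (.inr 0) (.inl i) by simp)
    rw [hx] at this
    cases h : σ (.inl i) <;> simp [h] at this ⊢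
  obtain ⟨w, hw⟩ := hside' 2
  obtain ⟨y, hy⟩ := hside 1
  obtain ⟨z, hz⟩ := hside 2
  have hw2 : w = 2 := by
    have a : w ≠ 0 := fun h => absurd (σ.injective (hw.trans (by rw [h, hu]))) (by decide)
    have b : w ≠ 1 := fun h => absurd (σ.injective (hw.trans (by rw [h, hv]))) (by decide)
    omega
  have hy0 : y ≠ 0 := fun h => absurd (σ.injective (hy.trans (by rw [h, hx]))) (by decide)
  have hz0 : z ≠ 0 := fun h => absurd (σ.injective (hz.trans (by rw [h, hx]))) (by decide)
  have hyz : y ≠ z := fun h => absurd (σ.injective (hy.trans (by rw [h, hz]))) (by decide)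
  obtain rfl | rfl : y = 1 ∨ y = 2 := by omega
  · obtain rfl : z = 2 := by omega
    refine eq_one_of_fixes connected_ncg (fun p => ?_) h0
    rw [hσ]
    subst hw2
    rcases p with ⟨i | i, g⟩ <;> fin_cases i <;> assumption
  · obtain rfl : z = 1 := by omega
    exact (not_lift_transposition hn hσ h0 hu hv hx hy hz).elim

/-- An automorphism of the cover is determined by its values on the base arc. -/
theorem eq_of_eq_base (hn : 7 ≤ n) {f g : ncg n r ≃g ncg n r}
    (h0 : f (.inl 0, 1) = g (.inl 0, 1)) (h1 : f (.inr 0, 1) = g (.inr 0, 1))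
    (h2 : f (next (.inr 0, 1) (.inl 1)) = g (next (.inr 0, 1) (.inl 1))) : f = g := by
  rw [← inv_mul_eq_one]
  apply eq_one_of_fixes_base hn
  · rw [RelIso.mul_apply, ← h0, RelIso.inv_apply_self]
  · rw [RelIso.mul_apply, ← h1, RelIso.inv_apply_self]
  · rw [RelIso.mul_apply, ← h2, RelIso.inv_apply_self]

end Semiregular

/-! ### Two-arc regularity and the type 2² -/

section Main

variable {n : ℕ} {r : ZMod n}

theorem exists_third (p q : (Fin 3 ⊕ Fin 3) × K n r) (h : (ncg n r).Adj p q) :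
    ∃ w, (ncg n r).Adj q w ∧ p ≠ w := by
  have : ∀ s t, K33.Adj s t → ∃ u, K33.Adj t u ∧ s ≠ u := by
    rintro (s | s) (t | t) h
    · simp at h
    · exact ⟨.inl (s + 1), by simp, by simp⟩
    · exact ⟨.inr (s + 1), by simp, by simp⟩
    · simp at h
  obtain ⟨u, hu, hne⟩ := this _ _ h.1
  exact ⟨next q u, adj_next hu, fun h => hne (congrArg Prod.fst h)⟩

variable [NeZero n] [hr : Fact (r ^ 2 + r + 1 = 0)]

theorem exists_map_arc {p q : (Fin 3 ⊕ Fin 3) × K n r} (h : (ncg n r).Adj p q) :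
    ∃ f : ncg n r ≃g ncg n r, f (.inl 0, 1) = p ∧ f (.inr 0, 1) = q := by
  obtain ⟨w, hqw, hpw⟩ := exists_third p q h
  obtain ⟨f, h0, h1, -⟩ := exists_map_two_arc h hqw hpw
  exact ⟨f, h0, h1⟩

theorem isSymmetric_ncg : IsSymmetric (ncg n r) := by
  intro p q hp hq
  obtain ⟨f, hf0, hf1⟩ := exists_map_arc (hp.1 0 (by omega))
  obtain ⟨g, hg0, hg1⟩ := exists_map_arc (hq.1 0 (by omega))
  refine ⟨g * f⁻¹, trivial, fun i => ?_⟩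
  rw [RelIso.mul_apply]
  fin_cases i
  · exact (congrArg (fun x => g (f⁻¹ x)) hf0).symm.trans (by rw [RelIso.inv_apply_self]; exact hg0)
  · exact (congrArg (fun x => g (f⁻¹ x)) hf1).symm.trans (by rw [RelIso.inv_apply_self]; exact hg1)

theorem exists_map_isArc {p : Fin (2 + 1) → (Fin 3 ⊕ Fin 3) × K n r} (hp : IsArc (ncg n r) 2 p) :
    ∃ f : ncg n r ≃g ncg n r, ∀ i, f (![(.inl 0, 1), (.inr 0, 1), next (.inr 0, 1) (.inl 1)] i) =
      p i := by
  obtain ⟨f, h0, h1, h2⟩ := exists_map_two_arc (hp.1 0 (by omega)) (hp.1 1 (by omega))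
    (hp.2 0 (by omega))
  exact ⟨f, fun i => by fin_cases i <;> assumption⟩

theorem isArcRegular_ncg (hn : 7 ≤ n) : IsArcRegular (ncg n r) ⊤ 2 := by
  constructor
  · intro p q hp hq
    obtain ⟨f, hf⟩ := exists_map_isArc hp
    obtain ⟨g, hg⟩ := exists_map_isArc hq
    exact ⟨g * f⁻¹, trivial, fun i => by
      rw [RelIso.mul_apply, ← hf, RelIso.inv_apply_self, hg]⟩
  · intro p hp f _ hfix
    obtain ⟨g, hg⟩ := exists_map_isArc hp
    have key : ∀ i, f (g (![(.inl 0, 1), (.inr 0, 1), next (.inr 0, 1) (.inl 1)] i)) =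
        g (![(.inl 0, 1), (.inr 0, 1), next (.inr 0, 1) (.inl 1)] i) := fun i => by
      rw [hg, hfix]
    exact mul_eq_right.mp (eq_of_eq_base hn (f := f * g) (g := g) (key 0) (key 1) (key 2))

/-- No involution of the cover reverses the base edge. -/
theorem not_reverses_base (hn : 7 ≤ n) {f : ncg n r ≃g ncg n r} (hf : f * f = 1)
    (h0 : f (.inl 0, 1) = (.inr 0, 1)) (h1 : f (.inr 0, 1) = (.inl 0, 1)) : False := by
  obtain ⟨τ, hτ, t0, t1⟩ := exists_lift_turn n r
  have hτ' : ∀ p, (τ⁻¹ p).1 = turn.symm p.1 := fun p => by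
    rw [RelIso.eq_symm_apply, ← hτ, RelIso.apply_inv_self]
  have t0' : τ⁻¹ (.inl 0, 1) = (.inr 0, 1) := by rw [← t1, RelIso.inv_apply_self]
  have t1' : τ⁻¹ (.inr 0, 1) = (.inl 0, 1) := by rw [← t0, RelIso.inv_apply_self]
  have hττ : τ * τ ≠ 1 := fun h => by
    have h2 : ((τ * τ) (.inl 1, 1)).1 = .inl 1 := by rw [h]; rfl
    rw [RelIso.mul_apply, hτ, hτ] at h2
    exact absurd h2 (show turn (turn (.inl 1)) ≠ .inl 1 by decide)
  have hadj : (ncg n r).Adj (.inr 0, 1) (next (.inr 0, 1) (.inl 1)) := adj_next (by simp)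
  have hfadj : ∀ g : ncg n r ≃g ncg n r, g (.inr 0, 1) = (.inl 0, 1) →
      (ncg n r).Adj (.inl 0, 1) (g (next (.inr 0, 1) (.inl 1))) := fun g hg =>
    hg ▸ g.map_adj_iff.mpr hadj
  -- `f` sends the third vertex of the base two-arc over `y` or `z`. `τ⁻¹` and `τ` realize these two
  -- cases, so `f` is one of them by rigidity.
  have hcases : (f (next (.inr 0, 1) (.inl 1))).1 = .inr 1 ∨
      (f (next (.inr 0, 1) (.inl 1))).1 = .inr 2 := by
    have hne : f (next (.inr 0, 1) (.inl 1)) ≠ (.inr 0, 1) := fun h => by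
      have := congrArg Prod.fst (f.injective (h.trans h0.symm))
      exact absurd this (by simp [next])
    have ha := hfadj f h1
    have hfst : (f (next (.inr 0, 1) (.inl 1))).1 ≠ .inr 0 := fun h =>
      hne (adj_unique ha (by simp [ncg_adj, voltage, voltMatrix]) h)
    have key : ∀ s, K33.Adj (.inl 0) s → s ≠ .inr 0 → s = .inr 1 ∨ s = .inr 2 := by decide
    exact key _ ha.1 hfst
  rcases hcases with h | h
  · have : f = τ⁻¹ := eq_of_eq_base hn (h0.trans t0'.symm) (h1.trans t1'.symm)
      (adj_unique (hfadj f h1) (hfadj _ t1') (by rw [h, hτ']; rfl))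
    rw [this, ← mul_inv_rev, inv_eq_one] at hf
    exact hττ hf
  · have : f = τ := eq_of_eq_base hn (h0.trans t0.symm) (h1.trans t1.symm)
      (adj_unique (hfadj f h1) (hfadj _ t1) (by rw [h, hτ]; rfl))
    exact hττ (this ▸ hf)

theorem isTypeTwoTwo_ncg (hn : 7 ≤ n) : IsTypeTwoTwo (ncg n r) ⊤ := by
  refine ⟨isArcRegular_ncg hn, ?_⟩
  rintro ⟨f, -, hf, p, q, hpq, hp, hq⟩
  obtain ⟨g, hg0, hg1⟩ := exists_map_arc hpq
  have hff : f * f = 1 := by rw [← pow_two, ← hf, pow_orderOf_eq_one]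
  -- Conjugation by `g` carries the reversed edge to the base edge.
  refine not_reverses_base hn (f := g⁻¹ * f * g) ?_ ?_ ?_
  · calc g⁻¹ * f * g * (g⁻¹ * f * g) = g⁻¹ * (f * f) * g := by group
      _ = 1 := by rw [hff]; group
  · rw [RelIso.mul_apply, RelIso.mul_apply, hg0, hp, ← hg1, RelIso.inv_apply_self]
  · rw [RelIso.mul_apply, RelIso.mul_apply, hg1, hq, ← hg0, RelIso.inv_apply_self]

end Main

end NCG

theorem theorem3p1 (n : ℕ) (hn : 7 ≤ n) (r : ZMod n) (hr : r ^ 2 + r + 1 = 0) :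
    Nat.card ((Fin 3 ⊕ Fin 3) × NCG.K n r) = 18 * n ^ 3 ∧
    (NCG.ncg n r).Connected ∧
    NCG.IsCubic (NCG.ncg n r) ∧
    NCG.IsSymmetric (NCG.ncg n r) ∧
    ¬ NCG.IsCayley (NCG.ncg n r) ∧
    Group.IsSolvable (NCG.ncg n r ≃g NCG.ncg n r) ∧
    NCG.IsTypeTwoTwo (NCG.ncg n r) ⊤ := by
  have : NeZero n := ⟨by omega⟩
  have : Fact (r ^ 2 + r + 1 = 0) := ⟨hr⟩
  refine ⟨?_, NCG.connected_ncg, NCG.isCubic_ncg, NCG.isSymmetric_ncg, fun h => ?_,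
    NCG.isSolvable_aut hn, NCG.isTypeTwoTwo_ncg hn⟩
  · rw [Nat.card_prod, NCG.card_K, Nat.card_eq_fintype_card]
    simp only [Fintype.card_sum, Fintype.card_fin]
    ring
  · obtain ⟨f, hf, x, y, hxy⟩ := NCG.exists_reversing_of_isCayley NCG.isCubic_ncg h
    exact (NCG.isTypeTwoTwo_ncg hn).2 ⟨f, trivial, hf, x, y, hxy⟩
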